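/- Norms are operator 2-norms. Consider floating point arithmetic with machine epsilon $\varepsilon$ in the standard model: the computed result of each operation $+,-,\times,/,\sqrt{\ }$ is $x(1+\delta)$ with $|\delta|\le\varepsilon$, where $x$ is the exact result of the operation (no overflow or underflow). Suppose we are given a multiplication procedure for square matrices that is stable: for $n\times n$ matrices $A,B$ the computed product satisfies $$\|C_{\rm comp}-AB\|\le \mu(n)\,\varepsilon\,\|A\|\,\|B\|+O(\varepsilon^2)\,\|A\|\,\|B\|,\qquad \mu(n)=O(n^{c'}),$$ where the constant in $O(\varepsilon^2)$ may depend on $n$. Rectangular products are computed by cutting the factors into square blocks (padded with zeros at the border) whose size is the smallest dimension involved, multiplying the blocks with the given procedure, and adding the block products in floating point. Let $[R,W,Y]=QRR(A)$ be the recursive QR decomposition of an $n\times m$ matrix $A$, $n\ge m\ge1$. It represents the orthogonal factor by $Q^T=I-WY$. If $m=1$, then $W,Y$ form a Householder transformation, normalized so that $\|W\|=1$, $Y=2W^T$, with $R=\pm\|A\|$ (for $A=0$: $W=e_1$, $Y=2e_1^T$, $R=0$). If $m\ge2$, let $k=\lfloor m/2\rfloor$ and $A=[A_L,A_R]$ with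 $k$ columns in $A_L$. Then compute, in order: (a) $[R_L,W_L,Y_L]=QRR(A_L)$; (b) $\begin{bmatrix}A_{12}\\A_{22}\end{bmatrix}=A_R-W_L(Y_LA_R)$, where $A_{12}$ has $k$ rows; (c) $[R_R,W_R,Y_R]=QRR(A_{22})$; (d) $X=W_L-\begin{bmatrix}0\\W_R(Y_RW_{L,2})\end{bmatrix}$, where $W_{L,2}$ consists of the last $n-k$ rows of $W_L$; and return $$R=\begin{bmatrix}R_L&A_{12}\\0&R_R\end{bmatrix},\quad W=\Big[X,\begin{bmatrix}0\\W_R\end{bmatrix}\Big],\quad Y=\begin{bmatrix}Y_L\\ [0,\,Y_R]\end{bmatrix}.$$ For square $A$ write $[Q,R]=QRR(A)$ when $Q=(I-WY)^T$ is then formed explicitly. For an $n\times n$ matrix $A$, the algorithm $[U,R,V]=RURV(A)$ draws an $n\times n$ matrix $B$ (with i.i.d. $N(0,1)$ entries) and computes $[V,R_0]=QRR(B)$, then $\hat A=A\,V^T$, then $[U,R]=QRR(\hat A)$. Claim. There are constants $K,c$, depending only on the multiplication procedure, such that for every $n$ there is $\varepsilon_0>0$ with the following property. For every $0<\varepsilon\le\varepsilon_0$,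 every real $n\times n$ matrix $A$, every value of the drawn matrix $B$, and every result $[U,R,V]$ that $RURV(A)$ may compute in floating point arithmetic with machine epsilon $\varepsilon$, there are exactly orthogonal matrices $\hat U,\hat V$ and a matrix $\delta A$ with $$A+\delta A=\hat U R\hat V,\qquad \|\delta A\|\le Kn^c\varepsilon\,\|A\|,\qquad \|U-\hat U\|\le Kn^c\varepsilon,\qquad \|V-\hat V\|\le Kn^c\varepsilon .$$ -/

import Mathlib

open scoped Matrix.Norms.L2Operator

/-! Matrix norms `‖·‖` below are the operator 2-norm (largest singular value). -/

noncomputable section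

namespace FloatURV

/-- Standard model of rounding (no overflow or underflow): `y` is a possible rounded value of the
exact result `x` of one arithmetic operation, in arithmetic with machine epsilon `ε`. -/
def FlRound (ε x y : ℝ) : Prop := ∃ δ : ℝ, |δ| ≤ ε ∧ y = x * (1 + δ)

/-- `FlSum ε s r`: `r` is a possible floating point sum of the numbers in `s`; the
additions may be carried out in any order. -/
inductive FlSum (ε : ℝ) : Multiset ℝ → ℝ → Prop
  | empty : FlSum ε 0 0
  | single (a : ℝ) : FlSum ε {a} a
  | add {s t : Multiset ℝ} {a b c : ℝ} (hs : s ≠ 0) (ht : t ≠ 0)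
      (ha : FlSum ε s a) (hb : FlSum ε t b) (hc : FlRound ε (a + b) c) : FlSum ε (s + t) c

/-- `C` is a possible floating point value of `A - B`. -/
def FlSub {m n : ℕ} (ε : ℝ) (A B C : Matrix (Fin m) (Fin n) ℝ) : Prop :=
  ∀ i j, FlRound ε (A i j - B i j) (C i j)

/-- A floating point multiplication procedure for square matrices: `mm ε n A B C` says that,
run with machine epsilon `ε` on the `n`-by-`n` matrices `A` and `B`, it may return `C`. -/
abbrev SquareMul : Type :=
  (ε : ℝ) → (n : ℕ) → (A B C : Matrix (Fin n) (Fin n) ℝ) → Prop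

/-- Stability of a multiplication procedure:
`‖C_comp - A B‖ ≤ μ(n) ε ‖A‖ ‖B‖ + O(ε²)` with `μ(n) = O(n ^ c)`. The second order term is
relative to `‖A‖ ‖B‖`, and its constant may depend on `n`. -/
def StableMul (mm : SquareMul) : Prop :=
  ∃ (μ : ℕ → ℝ) (K : ℝ) (c : ℕ), (∀ n, μ n ≤ K * (n : ℝ) ^ c) ∧
    ∀ n : ℕ, ∃ K₂ ε₀ : ℝ, 0 < ε₀ ∧ ∀ ε : ℝ, 0 < ε → ε ≤ ε₀ →
      ∀ A B C : Matrix (Fin n) (Fin n) ℝ, mm ε n A B C →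
        ‖C - A * B‖ ≤ μ n * ε * (‖A‖ * ‖B‖) + K₂ * ε ^ 2 * (‖A‖ * ‖B‖)

/-- The `(I, J)` block of size `d`-by-`d` of `A`, padded with zeros at the border. -/
def block {p q : ℕ} (d : ℕ) (A : Matrix (Fin p) (Fin q) ℝ) (I J : ℕ) :
    Matrix (Fin d) (Fin d) ℝ :=
  Matrix.of fun a b =>
    if h : I * d + (a : ℕ) < p ∧ J * d + (b : ℕ) < q then
      A ⟨I * d + (a : ℕ), h.1⟩ ⟨J * d + (b : ℕ), h.2⟩
    else 0

/-- Block size used for a `p`-by-`q` times `q`-by-`r` product: the smallest dimension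
(`1` if a dimension is zero). -/
def blockSize (p q r : ℕ) : ℕ := max 1 (min p (min q r))

/-- `C` is a possible computed product of the rectangular matrices `A` and `B`: they are cut into
square blocks whose size is the smallest dimension, the blocks are multiplied by `mm`, and
the block products are added in floating point. If all matrices are square, this is one call
of `mm`. -/
def FlMul (mm : SquareMul) (ε : ℝ) {p q r : ℕ} (A : Matrix (Fin p) (Fin q) ℝ)
    (B : Matrix (Fin q) (Fin r) ℝ) (C : Matrix (Fin p) (Fin r) ℝ) : Prop :=
  ∃ P : ℕ → ℕ → ℕ → Matrix (Fin (blockSize p q r)) (Fin (blockSize p q r)) ℝ,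
    (∀ I J K : ℕ, I * blockSize p q r < p → J * blockSize p q r < q → K * blockSize p q r < r →
      mm ε (blockSize p q r) (block (blockSize p q r) A I J) (block (blockSize p q r) B J K)
        (P I J K)) ∧
    ∀ (I K : ℕ) (a b : Fin (blockSize p q r)) (hi : I * blockSize p q r + (a : ℕ) < p)
      (hk : K * blockSize p q r + (b : ℕ) < r),
      FlSum ε ((Multiset.range (q ⌈/⌉ blockSize p q r)).map fun J => P I J K a b)
        (C ⟨I * blockSize p q r + (a : ℕ), hi⟩ ⟨K * blockSize p q r + (b : ℕ), hk⟩)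

/-- `s` is a possible floating point value of the Euclidean norm of `v`. -/
def FlNorm (ε : ℝ) {n : ℕ} (v : Fin n → ℝ) (s : ℝ) : Prop :=
  ∃ (sq : Fin n → ℝ) (t : ℝ), (∀ i, FlRound ε (v i * v i) (sq i)) ∧
    FlSum ε (Finset.univ.val.map sq) t ∧ FlRound ε (√t) s

/-- The sign used in a Householder transformation, with `sgn 0 = 1`. -/
def sgn (x : ℝ) : ℝ := if 0 ≤ x then 1 else -1

/-- Floating point Householder transformation for one column `x`. With `s` the computed norm of
`x`, the vector `v = x + sgn(x₁) s e₁` is normalized to `W`, `Y` is twice `Wᵀ`, and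
`R = -sgn(x₁) s`; exactly, `(I - W Y) x = R e₁`. If the computed norm is zero, then
`W = e₁`, `Y = 2 e₁ᵀ` and `R = 0`. -/
def FlHouseholder (ε : ℝ) {n : ℕ} (x : Matrix (Fin (n + 1)) (Fin 1) ℝ)
    (R : Matrix (Fin 1) (Fin 1) ℝ) (W : Matrix (Fin (n + 1)) (Fin 1) ℝ)
    (Y : Matrix (Fin 1) (Fin (n + 1)) ℝ) : Prop :=
  ∃ s : ℝ, FlNorm ε (fun i => x i 0) s ∧
    ((s = 0 ∧ R 0 0 = 0 ∧ (∀ i, W i 0 = if i = 0 then 1 else 0) ∧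
        ∀ i, Y 0 i = if i = 0 then 2 else 0) ∨
      (s ≠ 0 ∧ R 0 0 = -(sgn (x 0 0) * s) ∧
        ∃ (v : Fin (n + 1) → ℝ) (ν : ℝ),
          FlRound ε (x 0 0 + sgn (x 0 0) * s) (v 0) ∧ (∀ i, i ≠ 0 → v i = x i 0) ∧
          FlNorm ε v ν ∧ (∀ i, FlRound ε (v i / ν) (W i 0)) ∧
          ∀ i, FlRound ε (2 * W i 0) (Y 0 i)))

/-- `[A, B]`. -/
def hcat {n k l : ℕ} (A : Matrix (Fin n) (Fin k) ℝ) (B : Matrix (Fin n) (Fin l) ℝ) :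
    Matrix (Fin n) (Fin (k + l)) ℝ :=
  (Matrix.fromCols A B).submatrix id finSumFinEquiv.symm

/-- `[A; B]`. -/
def vcat {k p m : ℕ} (A : Matrix (Fin k) (Fin m) ℝ) (B : Matrix (Fin p) (Fin m) ℝ) :
    Matrix (Fin (k + p)) (Fin m) ℝ :=
  (Matrix.fromRows A B).submatrix finSumFinEquiv.symm id

/-- The recursive QR decomposition in floating point: `FlQRR mm ε n m A R W Y` says that
`[R, W, Y]` may be the computed output of `QRR(A)` for the `n`-by-`m` matrix `A`. A single
column is treated by a Householder transformation. Otherwise `A = [A_L, A_R]` with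
`k = ⌊m / 2⌋` columns in `A_L` and `l = ⌈m / 2⌉` columns in `A_R`, and `n = k + p`. -/
inductive FlQRR (mm : SquareMul) (ε : ℝ) : (n m : ℕ) → Matrix (Fin n) (Fin m) ℝ →
    Matrix (Fin m) (Fin m) ℝ → Matrix (Fin n) (Fin m) ℝ → Matrix (Fin m) (Fin n) ℝ → Prop
  | column {n : ℕ} {x : Matrix (Fin (n + 1)) (Fin 1) ℝ} {R : Matrix (Fin 1) (Fin 1) ℝ}
      {W : Matrix (Fin (n + 1)) (Fin 1) ℝ} {Y : Matrix (Fin 1) (Fin (n + 1)) ℝ}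
      (h : FlHouseholder ε x R W Y) : FlQRR mm ε (n + 1) 1 x R W Y
  | split {k l p : ℕ} (hk : 0 < k) (hkl : k = (k + l) / 2) (hlp : l ≤ p)
      {AL : Matrix (Fin (k + p)) (Fin k) ℝ} {AR : Matrix (Fin (k + p)) (Fin l) ℝ}
      -- (a) factor the left half
      {RL : Matrix (Fin k) (Fin k) ℝ} {WL : Matrix (Fin (k + p)) (Fin k) ℝ}
      {YL : Matrix (Fin k) (Fin (k + p)) ℝ}
      (hL : FlQRR mm ε (k + p) k AL RL WL YL)
      -- (b) update the right half: `[A12; A22] = AR - WL * (YL * AR)`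
      {S : Matrix (Fin k) (Fin l) ℝ} {T : Matrix (Fin (k + p)) (Fin l) ℝ}
      {A12 : Matrix (Fin k) (Fin l) ℝ} {A22 : Matrix (Fin p) (Fin l) ℝ}
      (hS : FlMul mm ε YL AR S) (hT : FlMul mm ε WL S T) (hA : FlSub ε AR T (vcat A12 A22))
      -- (c) factor the lower part of the right half
      {RR : Matrix (Fin l) (Fin l) ℝ} {WR : Matrix (Fin p) (Fin l) ℝ}
      {YR : Matrix (Fin l) (Fin p) ℝ}
      (hR : FlQRR mm ε p l A22 RR WR YR)
      -- (d) `X = WL - [0; WR * (YR * WL(k+1:n, 1:k))]`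
      {S' : Matrix (Fin l) (Fin k) ℝ} {T' : Matrix (Fin p) (Fin k) ℝ}
      {X : Matrix (Fin (k + p)) (Fin k) ℝ}
      (hS' : FlMul mm ε YR (WL.submatrix (Fin.natAdd k) id) S')
      (hT' : FlMul mm ε WR S' T') (hX : FlSub ε WL (vcat 0 T') X) :
      FlQRR mm ε (k + p) (k + l) (hcat AL AR) (vcat (hcat RL A12) (hcat 0 RR))
        (hcat X (vcat 0 WR)) (vcat YL (hcat 0 YR))

/-- `[Q, R] = QRR(A)` for a square matrix in floating point, where the orthogonal factor
`Q = (I - W Y)ᵀ` is multiplied out explicitly. -/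
def FlQR (mm : SquareMul) (ε : ℝ) {n : ℕ} (A Q R : Matrix (Fin n) (Fin n) ℝ) : Prop :=
  ∃ W Y P : Matrix (Fin n) (Fin n) ℝ,
    FlQRR mm ε n n A R W Y ∧ FlMul mm ε W Y P ∧ FlSub ε 1 P Q.transpose

/-- `[U, R, V]` may be the computed output of `RURV(A)` when `B` is the (Gaussian) matrix
that the algorithm draws:
`[V, R₀] = QRR(B)`, `Ahat = A * Vᵀ`, `[U, R] = QRR(Ahat)`. -/
def FlRURV (mm : SquareMul) (ε : ℝ) {n : ℕ} (A B U R V : Matrix (Fin n) (Fin n) ℝ) : Prop :=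
  ∃ R₀ Ahat : Matrix (Fin n) (Fin n) ℝ,
    FlQR mm ε B V R₀ ∧ FlMul mm ε A V.transpose Ahat ∧ FlQR mm ε Ahat U R

end FloatURV

end

/-!
Since `Qᵀ = 1 - W * Y` for the exact factors, one asks how far the computed `1 - W * Y` strays from
some exactly orthogonal matrix. At a leaf of the recursion the computed Householder vector has
almost unit norm, so its reflection is nearly that of the normalized vector. At an inner node, with
`D = diag(1, 1 - W_R Y_R)`, the update `X = D W_L` gives
`1 - [X, [0; W_R]] * [Y_L; [0, Y_R]] = D * (1 - W_L Y_L)`, a product of two nearly orthogonal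
matrices up to rounding. Relative errors therefore compound as a product of factors `1 + δ` over the
`2m - 1` nodes of the recursion tree, which grows only linearly in `m` once `δ` is small compared
with `1 / m`.

For RURV, let `V` and `U` be the orthogonal matrices close to the two computed ones, and `B` the
computed `A Vᵀ`. The backward error is
`U R V - A = ((B - A Vᵀ) - U (Uᵀ B - R)) V`, a sum of two small terms.
-/

open scoped Matrix.Norms.L2Operator

namespace FloatURV

open Filter Topology Matrix

section OperatorNorm

variable {m n o : Type*} [Fintype m] [Fintype n] [Fintype o] [DecidableEq n]

theorem sum_sq_col_le_norm_sq (A : Matrix m n ℝ) (j : n) : ∑ i, A i j ^ 2 ≤ ‖A‖ ^ 2 := by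
  have hcol := A.l2_opNorm_mulVec (EuclideanSpace.single j (1 : ℝ))
  rw [PiLp.norm_single, norm_one, mul_one, EuclideanSpace.norm_eq] at hcol
  simpa using (Real.sqrt_le_left (norm_nonneg A)).1 hcol

theorem abs_entry_le_norm (A : Matrix m n ℝ) (i : m) (j : n) : |A i j| ≤ ‖A‖ :=
  abs_le_of_sq_le_sq ((Finset.single_le_sum (f := fun i => A i j ^ 2) (fun _ _ => sq_nonneg _)
    (Finset.mem_univ i)).trans (sum_sq_col_le_norm_sq A j)) (norm_nonneg A)

theorem norm_sq_le_sum_sq (A : Matrix m n ℝ) : ‖A‖ ^ 2 ≤ ∑ i, ∑ j, A i j ^ 2 := by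
  have hS : 0 ≤ ∑ i, ∑ j, A i j ^ 2 := by positivity
  rw [← Real.le_sqrt (norm_nonneg A) hS, Matrix.l2_opNorm_def]
  refine ContinuousLinearMap.opNorm_le_bound _ (Real.sqrt_nonneg _) fun x => ?_
  rw [EuclideanSpace.norm_eq, EuclideanSpace.norm_eq, ← Real.sqrt_mul hS, Finset.sum_mul]
  simp only [Real.norm_eq_abs, sq_abs]
  exact Real.sqrt_le_sqrt <| Finset.sum_le_sum fun i _ =>
    Finset.sum_mul_sq_le_sq_mul_sq Finset.univ (A i) x

theorem norm_eq_sqrt_sum_sq_col {A : Matrix m (Fin 1) ℝ} : ‖A‖ = √(∑ i, A i 0 ^ 2) := by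
  refine le_antisymm (Real.le_sqrt_of_sq_le ?_)
    ((Real.sqrt_le_left (norm_nonneg A)).2 (sum_sq_col_le_norm_sq A 0))
  simpa using norm_sq_le_sum_sq A

theorem norm_le_of_forall_abs_le {N : ℕ} (hm : Fintype.card m ≤ N) (hn : Fintype.card n ≤ N)
    {A : Matrix m n ℝ} {c : ℝ} (hc : 0 ≤ c) (h : ∀ i j, |A i j| ≤ c) : ‖A‖ ≤ N * c := by
  refine abs_le_of_sq_le_sq' ?_ (by positivity) |>.2
  calc ‖A‖ ^ 2 ≤ ∑ i, ∑ j, A i j ^ 2 := norm_sq_le_sum_sq A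
    _ ≤ ∑ _i : m, ∑ _j : n, c ^ 2 := Finset.sum_le_sum fun i _ => Finset.sum_le_sum fun j _ =>
        sq_le_sq' (neg_le_of_abs_le (h i j)) (le_of_abs_le (h i j))
    _ = Fintype.card m * Fintype.card n * c ^ 2 := by simp [mul_assoc]
    _ ≤ N * N * c ^ 2 := by gcongr
    _ = (N * c) ^ 2 := by ring

theorem norm_le_of_forall_abs_le_mul {A B : Matrix m n ℝ} {c : ℝ} (hc : 0 ≤ c)
    (h : ∀ i j, |A i j| ≤ c * |B i j|) : ‖A‖ ≤ Fintype.card n * (c * ‖B‖) := by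
  refine abs_le_of_sq_le_sq' ?_ (by positivity) |>.2
  calc ‖A‖ ^ 2 ≤ ∑ i, ∑ j, A i j ^ 2 := norm_sq_le_sum_sq A
    _ ≤ ∑ i, ∑ j, c ^ 2 * B i j ^ 2 := by
        gcongr with i _ j _
        simpa [mul_pow] using sq_le_sq.2 ((h i j).trans_eq (abs_of_nonneg (by positivity)).symm)
    _ = c ^ 2 * ∑ j, ∑ i, B i j ^ 2 := by rw [Finset.sum_comm]; simp only [← Finset.mul_sum]
    _ ≤ c ^ 2 * ∑ _j : n, ‖B‖ ^ 2 := by gcongr with j _; exact sum_sq_col_le_norm_sq B j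
    _ = Fintype.card n * (c * ‖B‖) ^ 2 := by simp; ring
    _ ≤ Fintype.card n ^ 2 * (c * ‖B‖) ^ 2 := by
        gcongr
        exact_mod_cast Nat.le_self_pow two_ne_zero _
    _ = (Fintype.card n * (c * ‖B‖)) ^ 2 := by ring

theorem norm_transpose [DecidableEq m] (A : Matrix m n ℝ) : ‖Aᵀ‖ = ‖A‖ := by
  rw [← Matrix.conjTranspose_eq_transpose_of_trivial, Matrix.l2_opNorm_conjTranspose]

theorem norm_eq_of_transpose_mul_self_eq {A : Matrix m n ℝ} {B : Matrix o n ℝ}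
    (h : Aᵀ * A = Bᵀ * B) : ‖A‖ = ‖B‖ := by
  simp only [← Matrix.conjTranspose_eq_transpose_of_trivial] at h
  have hsq : ‖A‖ * ‖A‖ = ‖B‖ * ‖B‖ := by
    rw [← A.l2_opNorm_conjTranspose_mul_self, h, B.l2_opNorm_conjTranspose_mul_self]
  exact (mul_self_inj (norm_nonneg A) (norm_nonneg B)).1 hsq

theorem norm_one_le_one : ‖(1 : Matrix n n ℝ)‖ ≤ 1 := by
  rw [← Matrix.diagonal_one, Matrix.l2_opNorm_diagonal]
  exact (pi_norm_le_iff_of_nonneg zero_le_one).2 fun _ => by simp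

theorem norm_le_one_of_transpose_mul_self_eq_one {A : Matrix m n ℝ} (h : Aᵀ * A = 1) :
    ‖A‖ ≤ 1 :=
  (norm_eq_of_transpose_mul_self_eq (B := (1 : Matrix n n ℝ)) (by simpa using h)).trans_le
    norm_one_le_one

theorem transpose_mul_self_of_mem_orthogonalGroup {Q : Matrix n n ℝ}
    (hQ : Q ∈ Matrix.orthogonalGroup n ℝ) : Qᵀ * Q = 1 :=
  (Matrix.mem_orthogonalGroup_iff' n ℝ).1 hQ

theorem norm_orthogonal_le_one {Q : Matrix n n ℝ} (hQ : Q ∈ Matrix.orthogonalGroup n ℝ) :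
    ‖Q‖ ≤ 1 :=
  norm_le_one_of_transpose_mul_self_eq_one (transpose_mul_self_of_mem_orthogonalGroup hQ)

theorem norm_orthogonal_mul [DecidableEq o] {Q : Matrix n n ℝ}
    (hQ : Q ∈ Matrix.orthogonalGroup n ℝ) (A : Matrix n o ℝ) : ‖Q * A‖ = ‖A‖ :=
  norm_eq_of_transpose_mul_self_eq <| by
    rw [Matrix.transpose_mul, Matrix.mul_assoc, ← Matrix.mul_assoc Qᵀ,
      transpose_mul_self_of_mem_orthogonalGroup hQ, Matrix.one_mul]

theorem transpose_mem_orthogonalGroup {Q : Matrix n n ℝ} (hQ : Q ∈ Matrix.orthogonalGroup n ℝ) :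
    Qᵀ ∈ Matrix.orthogonalGroup n ℝ :=
  Matrix.transpose_mem_unitaryGroup_iff.2 hQ

end OperatorNorm

theorem norm_mul_sub_mul_le {R : Type*} [NormedRing R] {x x' y y' : R} {a b : ℝ}
    (hx : ‖x‖ ≤ 1) (hy : ‖y‖ ≤ 1) (hx' : ‖x' - x‖ ≤ a) (hy' : ‖y' - y‖ ≤ b) :
    ‖x' * y' - x * y‖ ≤ (1 + a) * (1 + b) - 1 := by
  have ha : 0 ≤ a := (norm_nonneg _).trans hx'
  calc ‖x' * y' - x * y‖
      = ‖(x' - x) * y + x * (y' - y) + (x' - x) * (y' - y)‖ := by congr 1; noncomm_ring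
    _ ≤ a * 1 + 1 * b + a * b := by
        refine norm_add₃_le.trans ?_
        gcongr <;> refine (norm_mul_le _ _).trans ?_ <;> gcongr
    _ = (1 + a) * (1 + b) - 1 := by ring

section Blocks

variable {k l m n p q : ℕ}

@[simp] theorem vcat_castAdd (A : Matrix (Fin k) (Fin m) ℝ) (B : Matrix (Fin p) (Fin m) ℝ)
    (i : Fin k) (j : Fin m) : vcat A B (Fin.castAdd p i) j = A i j := by simp [vcat]

@[simp] theorem vcat_natAdd (A : Matrix (Fin k) (Fin m) ℝ) (B : Matrix (Fin p) (Fin m) ℝ)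
    (i : Fin p) (j : Fin m) : vcat A B (Fin.natAdd k i) j = B i j := by simp [vcat]

@[simp] theorem hcat_castAdd (A : Matrix (Fin n) (Fin k) ℝ) (B : Matrix (Fin n) (Fin l) ℝ)
    (i : Fin n) (j : Fin k) : hcat A B i (Fin.castAdd l j) = A i j := by simp [hcat]

@[simp] theorem hcat_natAdd (A : Matrix (Fin n) (Fin k) ℝ) (B : Matrix (Fin n) (Fin l) ℝ)
    (i : Fin n) (j : Fin l) : hcat A B i (Fin.natAdd k j) = B i j := by simp [hcat]

theorem vcat_ext {A B : Matrix (Fin (k + p)) (Fin m) ℝ}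
    (hupper : ∀ i j, A (Fin.castAdd p i) j = B (Fin.castAdd p i) j)
    (hlower : ∀ i j, A (Fin.natAdd k i) j = B (Fin.natAdd k i) j) : A = B := by
  ext i j
  exact Fin.addCases (fun i => hupper i j) (fun i => hlower i j) i

theorem hcat_ext {A B : Matrix (Fin n) (Fin (k + l)) ℝ}
    (hleft : ∀ i j, A i (Fin.castAdd l j) = B i (Fin.castAdd l j))
    (hright : ∀ i j, A i (Fin.natAdd k j) = B i (Fin.natAdd k j)) : A = B := by
  ext i j
  exact Fin.addCases (hleft i) (hright i) j

theorem transpose_vcat (A : Matrix (Fin k) (Fin m) ℝ) (B : Matrix (Fin p) (Fin m) ℝ) :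
    (vcat A B)ᵀ = hcat Aᵀ Bᵀ := by
  refine hcat_ext ?_ ?_ <;> simp

theorem transpose_hcat (A : Matrix (Fin n) (Fin k) ℝ) (B : Matrix (Fin n) (Fin l) ℝ) :
    (hcat A B)ᵀ = vcat Aᵀ Bᵀ := by
  refine vcat_ext ?_ ?_ <;> simp

theorem mul_hcat (C : Matrix (Fin q) (Fin n) ℝ) (A : Matrix (Fin n) (Fin k) ℝ)
    (B : Matrix (Fin n) (Fin l) ℝ) : C * hcat A B = hcat (C * A) (C * B) := by
  refine hcat_ext ?_ ?_ <;> simp [Matrix.mul_apply]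

theorem vcat_mul (A : Matrix (Fin k) (Fin m) ℝ) (B : Matrix (Fin p) (Fin m) ℝ)
    (C : Matrix (Fin m) (Fin q) ℝ) : vcat A B * C = vcat (A * C) (B * C) := by
  refine vcat_ext ?_ ?_ <;> simp [Matrix.mul_apply]

theorem hcat_mul_vcat (A : Matrix (Fin n) (Fin k) ℝ) (B : Matrix (Fin n) (Fin l) ℝ)
    (C : Matrix (Fin k) (Fin m) ℝ) (D : Matrix (Fin l) (Fin m) ℝ) :
    hcat A B * vcat C D = A * C + B * D := by
  ext i j
  simp [Matrix.mul_apply, Fin.sum_univ_add]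

theorem hcat_sub (A A' : Matrix (Fin n) (Fin k) ℝ) (B B' : Matrix (Fin n) (Fin l) ℝ) :
    hcat A B - hcat A' B' = hcat (A - A') (B - B') := by
  refine hcat_ext ?_ ?_ <;> simp

theorem vcat_sub (A A' : Matrix (Fin k) (Fin m) ℝ) (B B' : Matrix (Fin l) (Fin m) ℝ) :
    vcat A B - vcat A' B' = vcat (A - A') (B - B') := by
  refine vcat_ext ?_ ?_ <;> simp

theorem vcat_submatrix (A : Matrix (Fin (k + p)) (Fin m) ℝ) :
    vcat (A.submatrix (Fin.castAdd p) id) (A.submatrix (Fin.natAdd k) id) = A := by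
  refine vcat_ext ?_ ?_ <;> simp

theorem hcat_zero_mul (Y : Matrix (Fin l) (Fin p) ℝ) (A : Matrix (Fin (k + p)) (Fin m) ℝ) :
    hcat (0 : Matrix (Fin l) (Fin k) ℝ) Y * A = Y * A.submatrix (Fin.natAdd k) id := by
  conv_lhs => rw [← vcat_submatrix A]
  rw [hcat_mul_vcat, Matrix.zero_mul, zero_add]

@[simp] theorem norm_zero_vcat (B : Matrix (Fin p) (Fin m) ℝ) :
    ‖vcat (0 : Matrix (Fin k) (Fin m) ℝ) B‖ = ‖B‖ :=
  norm_eq_of_transpose_mul_self_eq <| by simp [transpose_vcat, hcat_mul_vcat]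

@[simp] theorem norm_vcat_zero (A : Matrix (Fin k) (Fin m) ℝ) :
    ‖vcat A (0 : Matrix (Fin p) (Fin m) ℝ)‖ = ‖A‖ :=
  norm_eq_of_transpose_mul_self_eq <| by simp [transpose_vcat, hcat_mul_vcat]

@[simp] theorem norm_zero_hcat (B : Matrix (Fin n) (Fin l) ℝ) :
    ‖hcat (0 : Matrix (Fin n) (Fin k) ℝ) B‖ = ‖B‖ := by
  rw [← norm_transpose, transpose_hcat, Matrix.transpose_zero, norm_zero_vcat, norm_transpose]

@[simp] theorem norm_hcat_zero (A : Matrix (Fin n) (Fin k) ℝ) :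
    ‖hcat A (0 : Matrix (Fin n) (Fin l) ℝ)‖ = ‖A‖ := by
  rw [← norm_transpose, transpose_hcat, Matrix.transpose_zero, norm_vcat_zero, norm_transpose]

theorem norm_vcat_le (A : Matrix (Fin k) (Fin m) ℝ) (B : Matrix (Fin p) (Fin m) ℝ) :
    ‖vcat A B‖ ≤ ‖A‖ + ‖B‖ := by
  have hsplit : vcat A B = vcat A 0 + vcat 0 B := by refine vcat_ext ?_ ?_ <;> simp
  simpa only [hsplit, norm_vcat_zero, norm_zero_vcat] using norm_add_le (vcat A 0) (vcat 0 B)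

theorem norm_hcat_le (A : Matrix (Fin n) (Fin k) ℝ) (B : Matrix (Fin n) (Fin l) ℝ) :
    ‖hcat A B‖ ≤ ‖A‖ + ‖B‖ := by
  simpa only [← transpose_hcat, norm_transpose] using norm_vcat_le Aᵀ Bᵀ

theorem norm_le_norm_vcat_right (A : Matrix (Fin k) (Fin m) ℝ) (B : Matrix (Fin p) (Fin m) ℝ) :
    ‖B‖ ≤ ‖vcat A B‖ := by
  calc ‖B‖ = ‖hcat (0 : Matrix (Fin p) (Fin k) ℝ) (1 : Matrix (Fin p) (Fin p) ℝ) * vcat A B‖ := by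
        rw [hcat_mul_vcat, Matrix.zero_mul, Matrix.one_mul, zero_add]
    _ ≤ ‖hcat (0 : Matrix (Fin p) (Fin k) ℝ) (1 : Matrix (Fin p) (Fin p) ℝ)‖ * ‖vcat A B‖ :=
        Matrix.l2_opNorm_mul _ _
    _ ≤ ‖vcat A B‖ :=
        mul_le_of_le_one_left (norm_nonneg _) ((norm_zero_hcat _).trans_le norm_one_le_one)

theorem norm_le_norm_vcat_left (A : Matrix (Fin k) (Fin m) ℝ) (B : Matrix (Fin p) (Fin m) ℝ) :
    ‖A‖ ≤ ‖vcat A B‖ := by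
  calc ‖A‖ = ‖hcat (1 : Matrix (Fin k) (Fin k) ℝ) (0 : Matrix (Fin k) (Fin p) ℝ) * vcat A B‖ := by
        rw [hcat_mul_vcat, Matrix.zero_mul, Matrix.one_mul, add_zero]
    _ ≤ ‖hcat (1 : Matrix (Fin k) (Fin k) ℝ) (0 : Matrix (Fin k) (Fin p) ℝ)‖ * ‖vcat A B‖ :=
        Matrix.l2_opNorm_mul _ _
    _ ≤ ‖vcat A B‖ :=
        mul_le_of_le_one_left (norm_nonneg _) ((norm_hcat_zero _).trans_le norm_one_le_one)

theorem norm_le_norm_hcat_left (A : Matrix (Fin n) (Fin k) ℝ) (B : Matrix (Fin n) (Fin l) ℝ) :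
    ‖A‖ ≤ ‖hcat A B‖ := by
  simpa only [← transpose_hcat, norm_transpose] using norm_le_norm_vcat_left Aᵀ Bᵀ

theorem norm_le_norm_hcat_right (A : Matrix (Fin n) (Fin k) ℝ) (B : Matrix (Fin n) (Fin l) ℝ) :
    ‖B‖ ≤ ‖hcat A B‖ := by
  simpa only [← transpose_hcat, norm_transpose] using norm_le_norm_vcat_right Aᵀ Bᵀ

theorem norm_submatrix_natAdd_le (A : Matrix (Fin (k + p)) (Fin m) ℝ) :
    ‖A.submatrix (Fin.natAdd k) id‖ ≤ ‖A‖ := by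
  conv_rhs => rw [← vcat_submatrix A]
  exact norm_le_norm_vcat_right _ _

/-- The block diagonal matrix `diag(1, Q)`, through which the orthogonal factor of the lower right
block of a matrix acts on the whole matrix. -/
def oneDiag (k : ℕ) (Q : Matrix (Fin p) (Fin p) ℝ) : Matrix (Fin (k + p)) (Fin (k + p)) ℝ :=
  hcat (vcat 1 0) (vcat 0 Q)

theorem oneDiag_one : oneDiag k (1 : Matrix (Fin p) (Fin p) ℝ) = 1 := by
  refine hcat_ext ?_ ?_ <;> intro i j <;> refine Fin.addCases (fun i => ?_) (fun i => ?_) i <;>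
    simp [oneDiag, Matrix.one_apply, Fin.ext_iff] <;> omega

theorem transpose_oneDiag (Q : Matrix (Fin p) (Fin p) ℝ) : (oneDiag k Q)ᵀ = oneDiag k Qᵀ := by
  refine hcat_ext ?_ ?_ <;> intro i j <;> refine Fin.addCases (fun i => ?_) (fun i => ?_) i <;>
    simp [oneDiag, Matrix.one_apply, eq_comm]

theorem oneDiag_mul_vcat (Q : Matrix (Fin p) (Fin p) ℝ) (A : Matrix (Fin k) (Fin m) ℝ)
    (B : Matrix (Fin p) (Fin m) ℝ) : oneDiag k Q * vcat A B = vcat A (Q * B) := by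
  rw [oneDiag, hcat_mul_vcat, vcat_mul, vcat_mul]
  refine vcat_ext ?_ ?_ <;> simp

theorem oneDiag_mul_oneDiag (Q Q' : Matrix (Fin p) (Fin p) ℝ) :
    oneDiag k Q * oneDiag k Q' = oneDiag k (Q * Q') := by
  rw [oneDiag.eq_def k Q', mul_hcat, oneDiag_mul_vcat, oneDiag_mul_vcat, Matrix.mul_zero, oneDiag]

theorem oneDiag_mem_orthogonalGroup {Q : Matrix (Fin p) (Fin p) ℝ}
    (hQ : Q ∈ Matrix.orthogonalGroup (Fin p) ℝ) :
    oneDiag k Q ∈ Matrix.orthogonalGroup (Fin (k + p)) ℝ := by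
  rw [Matrix.mem_orthogonalGroup_iff] at hQ ⊢
  rw [transpose_oneDiag, oneDiag_mul_oneDiag, hQ, oneDiag_one]

theorem oneDiag_sub_oneDiag (Q Q' : Matrix (Fin p) (Fin p) ℝ) :
    oneDiag k Q - oneDiag k Q' = hcat 0 (vcat 0 (Q - Q')) := by
  simp [oneDiag, hcat_sub, vcat_sub]

theorem norm_oneDiag_sub_oneDiag (Q Q' : Matrix (Fin p) (Fin p) ℝ) :
    ‖oneDiag k Q - oneDiag k Q'‖ = ‖Q - Q'‖ := by
  rw [oneDiag_sub_oneDiag, norm_zero_hcat, norm_zero_vcat]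

theorem one_sub_vcat_mul_hcat (W : Matrix (Fin p) (Fin l) ℝ) (Y : Matrix (Fin l) (Fin p) ℝ) :
    1 - vcat (0 : Matrix (Fin k) (Fin l) ℝ) W * hcat 0 Y = oneDiag k (1 - W * Y) := by
  have h := oneDiag_sub_oneDiag (k := k) 1 (1 - W * Y)
  rw [oneDiag_one, sub_sub_cancel] at h
  rw [mul_hcat, Matrix.mul_zero, vcat_mul, Matrix.zero_mul, ← h, sub_sub_cancel]

/-- The `n`-by-`m` matrix `[R; 0]`, the triangular side of a QR decomposition whose orthogonal
factor is square; for `n < m` the last rows of `R` are dropped. -/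
def padRows (n : ℕ) (R : Matrix (Fin m) (Fin m) ℝ) : Matrix (Fin n) (Fin m) ℝ :=
  Matrix.of fun i j => if h : (i : ℕ) < m then R ⟨i, h⟩ j else 0

theorem padRows_self (R : Matrix (Fin n) (Fin n) ℝ) : padRows n R = R := by
  ext i j
  simp [padRows]

theorem padRows_add (R : Matrix (Fin k) (Fin k) ℝ) : padRows (k + p) R = vcat R 0 := by
  refine vcat_ext ?_ ?_ <;> simp [padRows]

theorem padRows_block (RL : Matrix (Fin k) (Fin k) ℝ) (A12 : Matrix (Fin k) (Fin l) ℝ)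
    (RR : Matrix (Fin l) (Fin l) ℝ) :
    padRows (k + p) (vcat (hcat RL A12) (hcat 0 RR))
      = hcat (vcat RL 0) (vcat A12 (padRows p RR)) := by
  refine vcat_ext (fun i j => ?_) fun i j => ?_
  · have hi : (i : ℕ) < k + l := i.2.trans_le (Nat.le_add_right k l)
    have hrow : (⟨i, hi⟩ : Fin (k + l)) = Fin.castAdd l i := rfl
    refine Fin.addCases (fun j => ?_) (fun j => ?_) j <;> simp [padRows, hi, hrow]
  · by_cases hi : (i : ℕ) < l
    · have hrow : (⟨k + i, Nat.add_lt_add_left hi k⟩ : Fin (k + l)) = Fin.natAdd k ⟨i, hi⟩ := rfl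
      refine Fin.addCases (fun j => ?_) (fun j => ?_) j <;>
        simp [-Fin.natAdd_mk, padRows, hi, hrow]
    · refine Fin.addCases (fun j => ?_) (fun j => ?_) j <;> simp [padRows, hi]

end Blocks

section Rounding

theorem one_add_pow_sub_one_le {x : ℝ} (hx : 0 ≤ x) {k : ℕ} (hk : k * x ≤ 1) :
    (1 + x) ^ k - 1 ≤ 2 * (k * x) := by
  have hexp : (1 + x) ^ k ≤ Real.exp (k * x) := by
    rw [Real.exp_nat_mul, add_comm]
    exact pow_le_pow_left₀ (by positivity) (Real.add_one_le_exp x) k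
  have hkx : |k * x| = k * x := abs_of_nonneg (by positivity)
  have hlin := Real.abs_exp_sub_one_le (hkx.trans_le hk)
  rw [hkx] at hlin
  linarith [le_abs_self (Real.exp (k * x) - 1)]

theorem FlSum.abs_sub_le {ε : ℝ} (hε : 0 ≤ ε) {s : Multiset ℝ} {r : ℝ} (h : FlSum ε s r) :
    |r - s.sum| ≤ ((1 + ε) ^ s.card - 1) * (s.map abs).sum := by
  induction h with
  | empty => simp
  | single a =>
    simp only [Multiset.sum_singleton, sub_self, abs_zero, Multiset.card_singleton, pow_one,
      add_sub_cancel_left, Multiset.map_singleton]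
    positivity
  | @add s t a b c hs ht _ _ hc iha ihb =>
    obtain ⟨δ, hδ, rfl⟩ := hc
    have hscard := Multiset.card_pos.2 hs
    have htcard := Multiset.card_pos.2 ht
    have hS : |s.sum| ≤ (s.map abs).sum := Multiset.abs_sum_le_sum_abs
    have hT : |t.sum| ≤ (t.map abs).sum := Multiset.abs_sum_le_sum_abs
    rw [Multiset.sum_add, Multiset.map_add, Multiset.sum_add, Multiset.card_add]
    set S := s.sum
    set T := t.sum
    set Z := (s.map abs).sum + (t.map abs).sum
    set γ := (1 + ε) ^ (s.card + t.card - 1) - 1 with hγ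
    have hγ_succ : (1 + ε) ^ (s.card + t.card) = (1 + γ) * (1 + ε) := by
      rw [hγ, add_sub_cancel, ← pow_succ]
      congr 1
      omega
    have ha : |a - S| ≤ γ * (s.map abs).sum := by
      refine iha.trans (mul_le_mul_of_nonneg_right ?_ ((abs_nonneg _).trans hS))
      exact sub_le_sub_right (pow_le_pow_right₀ (by linarith) (by omega)) 1
    have hb : |b - T| ≤ γ * (t.map abs).sum := by
      refine ihb.trans (mul_le_mul_of_nonneg_right ?_ ((abs_nonneg _).trans hT))
      exact sub_le_sub_right (pow_le_pow_right₀ (by linarith) (by omega)) 1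
    have hexact : |a + b - (S + T)| ≤ γ * Z := by
      rw [add_sub_add_comm, mul_add]
      exact (abs_add_le _ _).trans (add_le_add ha hb)
    have hsum : |a + b| ≤ (1 + γ) * Z := by
      linarith [abs_sub_abs_le_abs_sub (a + b) (S + T), abs_add_le S T]
    calc |(a + b) * (1 + δ) - (S + T)| = |(a + b - (S + T)) + (a + b) * δ| := by ring_nf
      _ ≤ γ * Z + (1 + γ) * Z * ε := by
          refine (abs_add_le _ _).trans (add_le_add hexact ?_)
          rw [abs_mul]
          exact mul_le_mul hsum hδ (abs_nonneg δ) ((abs_nonneg _).trans hsum)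
      _ = ((1 + ε) ^ (s.card + t.card) - 1) * Z := by rw [hγ_succ]; ring

section FinsetSum

variable {ι : Type*} {s : Finset ι} {f : ι → ℝ} {ε r : ℝ}

theorem FlSum.abs_sub_sum_le (hε : 0 ≤ ε) (hs : s.card * ε ≤ 1) (h : FlSum ε (s.val.map f) r) :
    |r - ∑ i ∈ s, f i| ≤ 2 * (s.card * ε) * ∑ i ∈ s, |f i| := by
  have hsum := h.abs_sub_le hε
  rw [Multiset.card_map, Multiset.map_map] at hsum
  exact hsum.trans (mul_le_mul_of_nonneg_right (one_add_pow_sub_one_le hε hs)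
    (Finset.sum_nonneg fun i _ => abs_nonneg (f i)))

theorem FlSum.abs_sub_sum_le_of_abs_sub_le (hε : 0 ≤ ε) (hs : s.card * ε ≤ 1) {g : ι → ℝ}
    {κ z : ℝ} (hκ : κ ≤ 1) (hz : 0 ≤ z) (hfg : ∀ i ∈ s, |f i - g i| ≤ κ * z)
    (hg : ∀ i ∈ s, |g i| ≤ z) (h : FlSum ε (s.val.map f) r) :
    |r - ∑ i ∈ s, g i| ≤ s.card * (κ + 4 * (s.card * ε)) * z := by
  have hf : ∑ i ∈ s, |f i| ≤ s.card * (2 * z) := by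
    rw [← nsmul_eq_mul]
    refine Finset.sum_le_card_nsmul _ _ _ fun i hi => ?_
    linarith [abs_sub_abs_le_abs_sub (f i) (g i), hfg i hi, hg i hi,
      mul_le_of_le_one_left hz hκ]
  have hfg_sum : |∑ i ∈ s, f i - ∑ i ∈ s, g i| ≤ s.card * (κ * z) := by
    rw [← Finset.sum_sub_distrib, ← nsmul_eq_mul]
    exact (Finset.abs_sum_le_sum_abs _ _).trans (Finset.sum_le_card_nsmul _ _ _ hfg)
  calc |r - ∑ i ∈ s, g i|
      ≤ 2 * (s.card * ε) * (s.card * (2 * z)) + s.card * (κ * z) :=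
        (_root_.abs_sub_le r (∑ i ∈ s, f i) (∑ i ∈ s, g i)).trans (add_le_add
          ((h.abs_sub_sum_le hε hs).trans (mul_le_mul_of_nonneg_left hf (by positivity)))
          hfg_sum)
    _ = s.card * (κ + 4 * (s.card * ε)) * z := by ring

end FinsetSum

variable {a b c x x' y y' z : ℝ}

theorem FlRound.abs_sub_le (h : FlRound a x y) : |y - x| ≤ a * |x| := by
  obtain ⟨δ, hδ, rfl⟩ := h
  rw [show x * (1 + δ) - x = δ * x by ring, abs_mul]
  exact mul_le_mul_of_nonneg_right hδ (abs_nonneg _)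

theorem FlRound.of_abs_sub_le (ha : 0 ≤ a) (h : |y - x| ≤ a * |x|) : FlRound a x y := by
  rcases eq_or_ne x 0 with rfl | hx
  · exact ⟨0, by simpa using ha, by simpa using h⟩
  · refine ⟨(y - x) / x, ?_, by field_simp; ring⟩
    rw [abs_div]
    exact (div_le_iff₀ (abs_pos.2 hx)).2 h

theorem FlRound.refl (ha : 0 ≤ a) (x : ℝ) : FlRound a x x := ⟨0, by simpa using ha, by simp⟩

theorem FlRound.mono (h : FlRound a x y) (hab : a ≤ b) : FlRound b x y := by
  obtain ⟨δ, hδ, rfl⟩ := h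
  exact ⟨δ, hδ.trans hab, rfl⟩

theorem FlRound.mul (h : FlRound a x x') (h' : FlRound b y y') :
    FlRound (a + b + a * b) (x * y) (x' * y') := by
  obtain ⟨δ, hδ, rfl⟩ := h
  obtain ⟨η, hη, rfl⟩ := h'
  have hδη : |δ * η| ≤ a * b := by
    rw [abs_mul]
    exact mul_le_mul hδ hη (abs_nonneg _) ((abs_nonneg _).trans hδ)
  exact ⟨δ + η + δ * η, by linarith [abs_add_le (δ + η) (δ * η), abs_add_le δ η], by ring⟩

theorem FlRound.trans (h : FlRound a x y) (h' : FlRound b y z) :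
    FlRound (a + b + a * b) x z := by
  obtain ⟨η, hη, rfl⟩ := h'
  simpa using h.mul (⟨η, hη, (one_mul _).symm⟩ : FlRound b 1 (1 + η))

theorem FlRound.div (h : FlRound a x x') (h' : FlRound b y y') (hb : b ≤ 1 / 2) :
    FlRound (2 * (a + b)) (x / y) (x' / y') := by
  obtain ⟨δ, hδ, rfl⟩ := h
  obtain ⟨η, hη, rfl⟩ := h'
  have hη_pos : 1 / 2 ≤ 1 + η := by linarith [neg_le_of_abs_le hη]
  have hsub : |δ - η| ≤ a + b := (abs_sub δ η).trans (add_le_add hδ hη)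
  refine ⟨(δ - η) / (1 + η), ?_, ?_⟩
  · rw [abs_div, abs_of_nonneg (by linarith : (0 : ℝ) ≤ 1 + η), div_le_iff₀ (by linarith)]
    nlinarith [(abs_nonneg (δ - η)).trans hsub]
  · have hη_ne : 1 + η ≠ 0 := by linarith
    rw [mul_div_mul_comm, one_add_div hη_ne]
    ring_nf

theorem FlRound.sqrt (h : FlRound a x y) (hx : 0 ≤ x) (ha : a ≤ 1) : FlRound a (√x) (√y) := by
  obtain ⟨δ, hδ, rfl⟩ := h
  have hδ_nonneg : 0 ≤ 1 + δ := by linarith [neg_le_of_abs_le hδ]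
  refine ⟨√(1 + δ) - 1, le_trans ?_ hδ, by rw [Real.sqrt_mul hx]; ring⟩
  have hfactor : (√(1 + δ) - 1) * (√(1 + δ) + 1) = δ := by
    linarith [Real.mul_self_sqrt hδ_nonneg]
  calc |√(1 + δ) - 1| ≤ |√(1 + δ) - 1| * |√(1 + δ) + 1| := by
        refine le_mul_of_one_le_right (abs_nonneg _) ?_
        linarith [le_abs_self (√(1 + δ) + 1), Real.sqrt_nonneg (1 + δ)]
    _ = |δ| := by rw [← abs_mul, hfactor]

theorem FlRound.sum {ι : Type*} {s : Finset ι} {f g : ι → ℝ} (ha : 0 ≤ a)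
    (hf : ∀ i ∈ s, 0 ≤ f i) (h : ∀ i ∈ s, FlRound a (f i) (g i)) :
    FlRound a (∑ i ∈ s, f i) (∑ i ∈ s, g i) := by
  refine .of_abs_sub_le ha ?_
  rw [← Finset.sum_sub_distrib, abs_of_nonneg (Finset.sum_nonneg hf), Finset.mul_sum]
  refine (Finset.abs_sum_le_sum_abs _ _).trans (Finset.sum_le_sum fun i hi => ?_)
  simpa only [abs_of_nonneg (hf i hi)] using (h i hi).abs_sub_le

theorem FlRound.eq_zero_iff (h : FlRound a x y) (ha : a < 1) : y = 0 ↔ x = 0 := by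
  obtain ⟨δ, hδ, rfl⟩ := h
  have hδ_pos : 0 < 1 + δ := by linarith [neg_le_of_abs_le hδ]
  simp [hδ_pos.ne']

theorem FlRound.nonneg (h : FlRound a x y) (ha : a ≤ 1) (hx : 0 ≤ x) : 0 ≤ y := by
  obtain ⟨δ, hδ, rfl⟩ := h
  exact mul_nonneg hx (by linarith [neg_le_of_abs_le hδ])

theorem FlNorm.flRound {ε τ : ℝ} {n : ℕ} (hε : 0 ≤ ε) (hετ : ε ≤ τ) (hnτ : n * ε ≤ τ)
    (hτ : τ ≤ 1 / 1000) {v : Fin n → ℝ} {s : ℝ} (h : FlNorm ε v s) :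
    FlRound (6 * τ) (√(∑ i, v i ^ 2)) s := by
  obtain ⟨sq, t, hsq, ht, hs⟩ := h
  have hsq_nonneg : ∀ i, 0 ≤ sq i := fun i =>
    (hsq i).nonneg (by linarith) (mul_self_nonneg _)
  have hsum_sq : FlRound ε (∑ i, v i ^ 2) (∑ i, sq i) :=
    .sum hε (fun i _ => sq_nonneg _) fun i _ => by simpa only [_root_.sq] using hsq i
  have hsum : FlRound (2 * τ) (∑ i, sq i) t := by
    refine .of_abs_sub_le (by linarith) ?_
    rw [abs_of_nonneg (Finset.sum_nonneg fun i _ => hsq_nonneg i)]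
    have hcard : ((Finset.univ : Finset (Fin n)).card : ℝ) * ε ≤ τ := by simpa using hnτ
    refine (ht.abs_sub_sum_le hε (by linarith)).trans ?_
    simp only [abs_of_nonneg (hsq_nonneg _)]
    gcongr
    exact Finset.sum_nonneg fun i _ => hsq_nonneg i
  have ht_round : FlRound (4 * τ) (∑ i, v i ^ 2) t := (hsum_sq.trans hsum).mono (by nlinarith)
  exact ((ht_round.sqrt (Finset.sum_nonneg fun i _ => sq_nonneg _) (by linarith)).trans hs).mono
    (by nlinarith)

end Rounding

section BlockMultiplication

variable {p q r d N : ℕ}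

theorem ceilDiv_le_self (hd : 0 < d) : q ⌈/⌉ d ≤ q := by
  rw [ceilDiv_le_iff_le_smul hd, smul_eq_mul]
  exact Nat.le_mul_of_pos_left q hd

theorem mul_lt_of_lt_ceilDiv (hd : 0 < d) {J : ℕ} (hJ : J < q ⌈/⌉ d) : J * d < q := by
  rwa [mul_comm, ← smul_eq_mul, ← not_le, ← ceilDiv_le_iff_le_smul hd, not_le]

theorem sum_range_mul {M : Type*} [AddCommMonoid M] (f : ℕ → M) (Q d : ℕ) :
    ∑ j ∈ Finset.range (Q * d), f j
      = ∑ J ∈ Finset.range Q, ∑ b ∈ Finset.range d, f (J * d + b) := by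
  induction Q with
  | zero => simp
  | succ Q ih => rw [Finset.sum_range_succ, ← ih, add_mul, one_mul, Finset.sum_range_add]

theorem sum_block_mul_block (hd : 0 < d) (A : Matrix (Fin p) (Fin q) ℝ)
    (B : Matrix (Fin q) (Fin r) ℝ) {I K : ℕ} {a b : Fin d} (hi : I * d + a < p)
    (hk : K * d + b < r) :
    ∑ J ∈ Finset.range (q ⌈/⌉ d), (block d A I J * block d B J K) a b
      = (A * B) ⟨I * d + a, hi⟩ ⟨K * d + b, hk⟩ := by
  set f : ℕ → ℝ := fun j =>
    if h : j < q then A ⟨I * d + a, hi⟩ ⟨j, h⟩ * B ⟨j, h⟩ ⟨K * d + b, hk⟩ else 0 with hf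
  have hq : q ≤ q ⌈/⌉ d * d := by
    simpa only [smul_eq_mul, mul_comm] using le_smul_ceilDiv (b := q) hd
  calc ∑ J ∈ Finset.range (q ⌈/⌉ d), (block d A I J * block d B J K) a b
      = ∑ J ∈ Finset.range (q ⌈/⌉ d), ∑ j ∈ Finset.range d, f (J * d + j) := by
        refine Finset.sum_congr rfl fun J _ => ?_
        rw [Matrix.mul_apply, ← Fin.sum_univ_eq_sum_range]
        refine Finset.sum_congr rfl fun j _ => ?_
        by_cases hj : J * d + j < q <;> simp [block, hf, hj, hi, hk]
    _ = ∑ j ∈ Finset.range q, f j := by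
        rw [← sum_range_mul]
        refine (Finset.sum_subset (Finset.range_mono hq) fun j _ hj => ?_).symm
        exact dif_neg (by simpa using hj)
    _ = (A * B) ⟨I * d + a, hi⟩ ⟨K * d + b, hk⟩ := by
        rw [Matrix.mul_apply, ← Fin.sum_univ_eq_sum_range]
        exact Finset.sum_congr rfl fun j _ => by simp [hf]

theorem norm_block_le (hd : d ≤ N) (A : Matrix (Fin p) (Fin q) ℝ) (I J : ℕ) :
    ‖block d A I J‖ ≤ N * ‖A‖ := by
  refine norm_le_of_forall_abs_le (by simpa) (by simpa) (norm_nonneg A) fun a b => ?_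
  simp only [block, Matrix.of_apply]
  split_ifs
  · exact abs_entry_le_norm A _ _
  · simp

theorem exists_eq_mul_add (hd : 0 < d) (i : Fin p) :
    ∃ (I : ℕ) (a : Fin d) (h : I * d + a < p), i = ⟨I * d + a, h⟩ :=
  have hi : i / d * d + i % d = (i : ℕ) := Nat.div_add_mod' i d
  ⟨i / d, ⟨i % d, Nat.mod_lt _ hd⟩, hi.trans_lt i.2, Fin.ext hi.symm⟩

theorem blockSize_pos : 0 < blockSize p q r := by simp [blockSize]

theorem blockSize_le (hN : 1 ≤ N) (hp : p ≤ N) : blockSize p q r ≤ N := by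
  simp [blockSize, hN, hp]

variable {mm : SquareMul} {ε κ : ℝ} {A : Matrix (Fin p) (Fin q) ℝ}
  {B : Matrix (Fin q) (Fin r) ℝ} {C : Matrix (Fin p) (Fin r) ℝ}

theorem FlMul.abs_entry_sub_le (hε : 0 ≤ ε) (hNε : N * ε ≤ 1) (hκ : 0 ≤ κ) (hκ_le : κ ≤ 1)
    (hmm : ∀ d ≤ N, ∀ A B C : Matrix (Fin d) (Fin d) ℝ, mm ε d A B C →
      ‖C - A * B‖ ≤ κ * (‖A‖ * ‖B‖))
    (hN : 1 ≤ N) (hp : p ≤ N) (hq : q ≤ N) (h : FlMul mm ε A B C) (i : Fin p) (j : Fin r) :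
    |C i j - (A * B) i j| ≤ N * (κ + 4 * (N * ε)) * (N ^ 2 * (‖A‖ * ‖B‖)) := by
  obtain ⟨P, hP, hC⟩ := h
  have hd : 0 < blockSize p q r := blockSize_pos
  have hdN : blockSize p q r ≤ N := blockSize_le hN hp
  generalize blockSize p q r = d at *
  obtain ⟨I, a, hi, rfl⟩ := exists_eq_mul_add hd i
  obtain ⟨K, b, hj, rfl⟩ := exists_eq_mul_add hd j
  have hblocks (J : ℕ) : ‖block d A I J‖ * ‖block d B J K‖ ≤ N ^ 2 * (‖A‖ * ‖B‖) :=
    (mul_le_mul (norm_block_le hdN A I J) (norm_block_le hdN B J K) (norm_nonneg _)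
      (by positivity)).trans_eq (by ring)
  have hblock_mul (J : ℕ) : |(block d A I J * block d B J K) a b| ≤ N ^ 2 * (‖A‖ * ‖B‖) :=
    (abs_entry_le_norm _ a b).trans ((Matrix.l2_opNorm_mul _ _).trans (hblocks J))
  have hblock_err : ∀ J ∈ Finset.range (q ⌈/⌉ d),
      |P I J K a b - (block d A I J * block d B J K) a b| ≤ κ * (N ^ 2 * (‖A‖ * ‖B‖)) := by
    intro J hJ
    have hJ_lt := mul_lt_of_lt_ceilDiv hd (Finset.mem_range.1 hJ)
    exact ((abs_entry_le_norm (P I J K - block d A I J * block d B J K) a b).trans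
      (hmm d hdN _ _ _ (hP I J K (by omega) hJ_lt (by omega)))).trans
      (mul_le_mul_of_nonneg_left (hblocks J) hκ)
  have hcard : ((Finset.range (q ⌈/⌉ d)).card : ℝ) ≤ N := by
    exact_mod_cast (Finset.card_range _).trans_le ((ceilDiv_le_self hd).trans hq)
  have hsum := FlSum.abs_sub_sum_le_of_abs_sub_le hε
    ((mul_le_mul_of_nonneg_right hcard hε).trans hNε) hκ_le (by positivity) hblock_err
    (fun J _ => hblock_mul J) (hC I K a b hi hj)
  rw [sum_block_mul_block hd] at hsum
  refine hsum.trans ?_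
  gcongr

theorem FlMul.norm_sub_le (hε : 0 ≤ ε) (hNε : N * ε ≤ 1) (hκ : 0 ≤ κ) (hκ_le : κ ≤ 1)
    (hmm : ∀ d ≤ N, ∀ A B C : Matrix (Fin d) (Fin d) ℝ, mm ε d A B C →
      ‖C - A * B‖ ≤ κ * (‖A‖ * ‖B‖))
    (hN : 1 ≤ N) (hp : p ≤ N) (hq : q ≤ N) (hr : r ≤ N) (h : FlMul mm ε A B C) :
    ‖C - A * B‖ ≤ N ^ 4 * (κ + 4 * (N * ε)) * (‖A‖ * ‖B‖) :=
  (norm_le_of_forall_abs_le (by simpa) (by simpa) (by positivity)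
    (h.abs_entry_sub_le hε hNε hκ hκ_le hmm hN hp hq)).trans_eq (by ring)

end BlockMultiplication

section ModelAssumptions

/-- The accuracy that the recursive decomposition needs from the arithmetic, with one normwise
error unit `η` for all matrices of dimension at most `N`: `η` bounds the relative error of a
computed product, and, through `N * ε ≤ η`, that of a computed difference or column norm. -/
structure AccurateArithmetic (mm : SquareMul) (ε : ℝ) (N : ℕ) (η : ℝ) : Prop where
  eps_nonneg : 0 ≤ ε
  dim_mul_eps_le : N * ε ≤ η
  norm_mul_sub_le : ∀ {p q r : ℕ}, p ≤ N → q ≤ N → r ≤ N → ∀ {A : Matrix (Fin p) (Fin q) ℝ}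
    {B : Matrix (Fin q) (Fin r) ℝ} {C : Matrix (Fin p) (Fin r) ℝ}, FlMul mm ε A B C →
    ‖C - A * B‖ ≤ η * (‖A‖ * ‖B‖)

theorem eventually_mul_le_one (c : ℝ) : ∀ᶠ ε in 𝓝[>] (0 : ℝ), c * ε ≤ 1 := by
  have hlim : Tendsto (fun ε : ℝ => c * ε) (𝓝[>] 0) (𝓝 0) :=
    tendsto_nhdsWithin_of_tendsto_nhds (by simpa using (continuous_const_mul c).tendsto 0)
  exact hlim.eventually (eventually_le_nhds zero_lt_one)

variable {mm : SquareMul}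

theorem StableMul.exists_eventually_norm_sub_le (h : StableMul mm) :
    ∃ (K : ℝ) (c : ℕ), 0 ≤ K ∧ ∀ N : ℕ, 1 ≤ N → ∀ᶠ ε in 𝓝[>] (0 : ℝ), ∀ d ≤ N,
      ∀ A B C : Matrix (Fin d) (Fin d) ℝ, mm ε d A B C →
        ‖C - A * B‖ ≤ K * N ^ c * ε * (‖A‖ * ‖B‖) := by
  obtain ⟨μ, K, c, hμ, hmm⟩ := h
  refine ⟨|K| + 1, c, by positivity, fun N hN => ?_⟩
  refine (eventually_all_finite (Set.finite_Iic N)).2 fun d hd => ?_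
  obtain ⟨K₂, ε₀, hε₀, hbound⟩ := hmm d
  filter_upwards [Ioc_mem_nhdsGT hε₀, eventually_mul_le_one K₂] with ε hε hK₂ A B C hC
  have hd_pow : (d : ℝ) ^ c ≤ N ^ c := by
    have hdN : (d : ℝ) ≤ N := Nat.cast_le.2 hd
    gcongr
  have hN_pow : (1 : ℝ) ≤ N ^ c := one_le_pow₀ (Nat.one_le_cast.2 hN)
  have hμ_le : μ d ≤ |K| * N ^ c :=
    (hμ d).trans (mul_le_mul (le_abs_self K) hd_pow (by positivity) (abs_nonneg K))
  have hε_pos := hε.1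
  calc ‖C - A * B‖ ≤ μ d * ε * (‖A‖ * ‖B‖) + K₂ * ε ^ 2 * (‖A‖ * ‖B‖) :=
        hbound ε hε.1 hε.2 A B C hC
    _ = (μ d + K₂ * ε) * (ε * (‖A‖ * ‖B‖)) := by ring
    _ ≤ (|K| * N ^ c + N ^ c) * (ε * (‖A‖ * ‖B‖)) := by
        gcongr
        exact hK₂.trans hN_pow
    _ = (|K| + 1) * N ^ c * ε * (‖A‖ * ‖B‖) := by ring

theorem StableMul.exists_eventually_accurateArithmetic (h : StableMul mm) :
    ∃ (C : ℝ) (e : ℕ), ∀ N : ℕ, 1 ≤ N →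
      ∀ᶠ ε in 𝓝[>] (0 : ℝ), AccurateArithmetic mm ε N (C * N ^ e * ε) := by
  obtain ⟨K, c, hK, hmm⟩ := h.exists_eventually_norm_sub_le
  refine ⟨K + 4, c + 5, fun N hN => ?_⟩
  have hN' : (1 : ℝ) ≤ N := Nat.one_le_cast.2 hN
  filter_upwards [hmm N hN, eventually_mul_le_one N, eventually_mul_le_one (K * N ^ c),
    self_mem_nhdsWithin] with ε hsq hNε hκ (hε : 0 < ε)
  refine ⟨hε.le, ?_, fun hp hq hr A B C hC => ?_⟩
  · gcongr
    calc (N : ℝ) = 1 * N ^ 1 := by ring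
      _ ≤ (K + 4) * N ^ (c + 5) := by
        gcongr
        · linarith
        · omega
  · refine (hC.norm_sub_le hε.le hNε (by positivity) hκ hsq hN hp hq hr).trans ?_
    refine mul_le_mul_of_nonneg_right ?_ (by positivity)
    calc (N : ℝ) ^ 4 * (K * N ^ c * ε + 4 * (N * ε))
        = (K * N ^ (c + 4) + 4 * N ^ 5) * ε := by ring
      _ ≤ (K * N ^ (c + 5) + 4 * N ^ (c + 5)) * ε := by gcongr <;> first | exact hN' | omega
      _ = (K + 4) * N ^ (c + 5) * ε := by ring

end ModelAssumptions

section Column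

variable {n : Type*} [Fintype n]

theorem transpose_mul_self_col (x : Matrix n (Fin 1) ℝ) : xᵀ * x = ‖x‖ ^ 2 • 1 := by
  ext i j
  rw [Subsingleton.elim i 0, Subsingleton.elim j 0, norm_eq_sqrt_sum_sq_col,
    Real.sq_sqrt (Finset.sum_nonneg fun i _ => sq_nonneg _)]
  simp [Matrix.mul_apply, sq]

theorem transpose_mul_comm_col (x y : Matrix n (Fin 1) ℝ) : xᵀ * y = yᵀ * x := by
  ext i j
  rw [Subsingleton.elim i 0, Subsingleton.elim j 0]
  simp [Matrix.mul_apply, mul_comm]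

theorem transpose_mul_self_normalize {u : Matrix n (Fin 1) ℝ} (hu : u ≠ 0) :
    (‖u‖⁻¹ • u)ᵀ * (‖u‖⁻¹ • u) = 1 := by
  have hu_norm : ‖u‖ ≠ 0 := norm_ne_zero_iff.2 hu
  rw [transpose_smul, Matrix.smul_mul, Matrix.mul_smul, transpose_mul_self_col, smul_smul,
    smul_smul]
  field_simp
  exact one_smul ℝ _

end Column

section Reflector

variable {m n : Type*} [Fintype m] [Fintype n] [DecidableEq m] [DecidableEq n]

/-- The reflection `1 - 2 w wᵀ`; for `w` with orthonormal columns it is orthogonal, and for a single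
column it is the Householder transformation with unit normal vector `w`. -/
def reflector (w : Matrix n m ℝ) : Matrix n n ℝ := 1 - (2 : ℝ) • (w * wᵀ)

theorem reflector_mem_orthogonalGroup {w : Matrix n m ℝ} (hw : wᵀ * w = 1) :
    reflector w ∈ Matrix.orthogonalGroup n ℝ := by
  have hproj : w * wᵀ * (w * wᵀ) = w * wᵀ := by
    rw [Matrix.mul_assoc, ← Matrix.mul_assoc wᵀ, hw, Matrix.one_mul]
  rw [Matrix.mem_orthogonalGroup_iff]
  simp only [reflector, transpose_sub, transpose_one, transpose_smul, transpose_mul,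
    transpose_transpose, sub_mul, mul_sub, smul_mul_assoc, mul_smul_comm, hproj, one_mul, mul_one]
  module

theorem norm_one_sub_mul_sub_reflector_le {w W : Matrix n m ℝ} {Y : Matrix m n ℝ} {τ : ℝ}
    (hτ : τ ≤ 1 / 2) (hw : wᵀ * w = 1) (hW : ‖W - w‖ ≤ τ) (hY : ‖Y - (2 : ℝ) • wᵀ‖ ≤ 2 * τ) :
    ‖1 - W * Y - reflector w‖ ≤ 5 * τ := by
  have hw_norm : ‖w‖ ≤ 1 := norm_le_one_of_transpose_mul_self_eq_one hw
  have h2w_norm : ‖(2 : ℝ) • wᵀ‖ ≤ 2 := by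
    rw [norm_smul, norm_transpose]
    norm_num
    linarith
  have hτ_nonneg : 0 ≤ τ := (norm_nonneg _).trans hW
  have hsplit : 1 - W * Y - reflector w
      = -((W - w) * (2 : ℝ) • wᵀ + w * (Y - (2 : ℝ) • wᵀ) + (W - w) * (Y - (2 : ℝ) • wᵀ)) := by
    simp only [reflector, Matrix.sub_mul, Matrix.mul_sub, Matrix.mul_smul]
    abel
  calc ‖1 - W * Y - reflector w‖ ≤ τ * 2 + 1 * (2 * τ) + τ * (2 * τ) := by
        rw [hsplit, norm_neg]
        refine norm_add₃_le.trans ?_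
        gcongr <;> refine (Matrix.l2_opNorm_mul _ _).trans ?_ <;> gcongr
    _ ≤ 5 * τ := by nlinarith

variable {x y : Matrix n (Fin 1) ℝ}

theorem reflector_normalize_sub_mul (hnorm : ‖x‖ = ‖y‖) (hne : x ≠ y) :
    reflector (‖x - y‖⁻¹ • (x - y)) * x = y := by
  have hu_norm : ‖x - y‖ ≠ 0 := norm_ne_zero_iff.2 (sub_ne_zero.2 hne)
  have hinner : (2 : ℝ) • ((x - y)ᵀ * x) = ‖x - y‖ ^ 2 • 1 := by
    rw [← transpose_mul_self_col, Matrix.mul_sub, transpose_sub, Matrix.sub_mul, Matrix.sub_mul,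
      transpose_mul_self_col y, ← hnorm, ← transpose_mul_self_col x, transpose_mul_comm_col y x]
    module
  have hscale : (2 : ℝ) * (‖x - y‖⁻¹ * ‖x - y‖⁻¹) = (‖x - y‖ ^ 2)⁻¹ * 2 := by ring
  calc reflector (‖x - y‖⁻¹ • (x - y)) * x
      = x - (‖x - y‖ ^ 2)⁻¹ • ((x - y) * ((2 : ℝ) • ((x - y)ᵀ * x))) := by
        simp only [reflector, Matrix.sub_mul, Matrix.one_mul, transpose_smul, Matrix.smul_mul,
          Matrix.mul_smul, smul_smul, Matrix.mul_assoc, hscale]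
    _ = x - (x - y) := by
        rw [hinner, Matrix.mul_smul, Matrix.mul_one, smul_smul,
          inv_mul_cancel₀ (pow_ne_zero 2 hu_norm), one_smul]
    _ = y := sub_sub_cancel x y

end Reflector

section Householder

theorem sgn_mul_sgn (x : ℝ) : sgn x * sgn x = 1 := by
  unfold sgn
  split_ifs <;> norm_num

theorem abs_sgn (x : ℝ) : |sgn x| = 1 := by
  unfold sgn
  split_ifs <;> norm_num

theorem sgn_mul_self (x : ℝ) : sgn x * x = |x| := by
  unfold sgn
  split_ifs with h
  · rw [abs_of_nonneg h, one_mul]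
  · rw [abs_of_neg (not_le.1 h), neg_one_mul]

variable {n : ℕ} {ε τ : ℝ} {x : Matrix (Fin (n + 1)) (Fin 1) ℝ} {R : Matrix (Fin 1) (Fin 1) ℝ}
  {W : Matrix (Fin (n + 1)) (Fin 1) ℝ} {Y : Matrix (Fin 1) (Fin (n + 1)) ℝ}

theorem norm_single_col (i : Fin n) (a : ℝ) :
    ‖(Matrix.single i 0 a : Matrix (Fin n) (Fin 1) ℝ)‖ = |a| := by
  rw [norm_eq_sqrt_sum_sq_col, ← Real.sqrt_sq_eq_abs]
  congr 1
  rw [Finset.sum_eq_single i] <;> simp +contextual [eq_comm]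

theorem padRows_one_by_one (R : Matrix (Fin 1) (Fin 1) ℝ) :
    padRows (n + 1) R = Matrix.single 0 0 (R 0 0) := by
  ext i j
  rw [Subsingleton.elim j 0]
  by_cases hi : i = 0
  · simp [padRows, hi]
  · simp [padRows, hi, Ne.symm hi]

/-- The multiple `-sgn(x₁) ‖x‖ e₁` of the first unit vector onto which the exact Householder
transformation reflects the column `x`; the sign is the one that avoids cancellation. -/
noncomputable def householderImage (x : Matrix (Fin (n + 1)) (Fin 1) ℝ) :
    Matrix (Fin (n + 1)) (Fin 1) ℝ :=
  Matrix.single 0 0 (-(sgn (x 0 0) * ‖x‖))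

theorem norm_householderImage (x : Matrix (Fin (n + 1)) (Fin 1) ℝ) :
    ‖householderImage x‖ = ‖x‖ := by
  rw [householderImage, norm_single_col, abs_neg, abs_mul, abs_sgn, one_mul, abs_norm]

theorem norm_householderImage_sub_single (x : Matrix (Fin (n + 1)) (Fin 1) ℝ) (s : ℝ) :
    ‖householderImage x - Matrix.single 0 0 (-(sgn (x 0 0) * s))‖ = |s - ‖x‖| := by
  have hdiff : householderImage x - Matrix.single 0 0 (-(sgn (x 0 0) * s))
      = Matrix.single 0 0 (sgn (x 0 0) * (s - ‖x‖)) := by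
    rw [householderImage, sub_eq_iff_eq_add, ← Matrix.single_add]
    congr 1
    ring
  rw [hdiff, norm_single_col, abs_mul, abs_sgn, one_mul]

theorem sub_householderImage_zero (x : Matrix (Fin (n + 1)) (Fin 1) ℝ) :
    (x - householderImage x) 0 0 = sgn (x 0 0) * (|x 0 0| + ‖x‖) := by
  rw [← sgn_mul_self, mul_add, ← mul_assoc, sgn_mul_sgn]
  simp [householderImage]

theorem sub_householderImage_ne_zero {i : Fin (n + 1)} (hi : i ≠ 0) :
    (x - householderImage x) i 0 = x i 0 := by
  simp [householderImage, Ne.symm hi]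

theorem ne_householderImage (hx : x ≠ 0) : x ≠ householderImage x := by
  intro h
  have hzero : sgn (x 0 0) * (|x 0 0| + ‖x‖) = 0 := by
    rw [← sub_householderImage_zero, ← h, sub_self, Matrix.zero_apply]
  have habs : |x 0 0| + ‖x‖ = 0 := by
    simpa [abs_sgn] using congrArg abs hzero
  exact hx (norm_le_zero_iff.1 (by linarith [abs_nonneg (x 0 0)]))

/-- Forming `x₁ + sgn(x₁) ‖x‖` adds two numbers of the same sign, so it is relatively accurate. -/
theorem flRound_sub_householderImage (hε : 0 ≤ ε) (hετ : ε ≤ τ) (hτ : τ ≤ 1 / 1000) {s : ℝ}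
    {v : Fin (n + 1) → ℝ} (hs : FlRound (6 * τ) ‖x‖ s)
    (hv_zero : FlRound ε (x 0 0 + sgn (x 0 0) * s) (v 0)) (hv : ∀ i, i ≠ 0 → v i = x i 0)
    (i : Fin (n + 1)) : FlRound (8 * τ) ((x - householderImage x) i 0) (v i) := by
  have hτ_nonneg : 0 ≤ τ := hε.trans hετ
  by_cases hi : i = 0
  · subst hi
    refine FlRound.mono (FlRound.trans (a := 6 * τ) (.of_abs_sub_le (by positivity) ?_) hv_zero)
      (by nlinarith)
    have hdiff : x 0 0 + sgn (x 0 0) * s - sgn (x 0 0) * (|x 0 0| + ‖x‖)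
        = sgn (x 0 0) * (s - ‖x‖) := by
      rw [← sgn_mul_self]
      linear_combination (-x 0 0) * sgn_mul_sgn (x 0 0)
    rw [sub_householderImage_zero, hdiff, abs_mul, abs_mul, abs_sgn, one_mul, one_mul,
      abs_of_nonneg (by positivity : 0 ≤ |x 0 0| + ‖x‖)]
    refine hs.abs_sub_le.trans ?_
    rw [abs_norm]
    gcongr
    exact le_add_of_nonneg_left (abs_nonneg _)
  · rw [sub_householderImage_ne_zero hi, hv i hi]
    exact .refl (by positivity) _

theorem flRound_normalize (hε : 0 ≤ ε) (hετ : ε ≤ τ) (hnτ : n * ε ≤ τ) (hτ : τ ≤ 1 / 1000)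
    {u w : Matrix (Fin n) (Fin 1) ℝ} {v : Fin n → ℝ} {ν : ℝ}
    (hv : ∀ i, FlRound (8 * τ) (u i 0) (v i)) (hν : FlNorm ε v ν)
    (hw : ∀ i, FlRound ε (v i / ν) (w i 0)) (i : Fin n) :
    FlRound (70 * τ) ((‖u‖⁻¹ • u) i 0) (w i 0) := by
  have hsum_sq : FlRound (17 * τ) (∑ i, u i 0 ^ 2) (∑ i, v i ^ 2) := by
    refine .sum (by linarith) (fun i _ => sq_nonneg _) fun i _ => ?_
    rw [sq, sq]
    exact ((hv i).mul (hv i)).mono (by nlinarith)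
  have hnorm : FlRound (24 * τ) ‖u‖ ν := by
    rw [norm_eq_sqrt_sum_sq_col]
    exact ((hsum_sq.sqrt (Finset.sum_nonneg fun i _ => sq_nonneg _) (by linarith)).trans
      (hν.flRound hε hετ hnτ hτ)).mono (by nlinarith)
  have hquot : FlRound (64 * τ) (u i 0 / ‖u‖) (v i / ν) :=
    ((hv i).div hnorm (by linarith)).mono (by linarith)
  rw [Matrix.smul_apply, smul_eq_mul, inv_mul_eq_div]
  exact (hquot.trans (hw i)).mono (by nlinarith)

theorem norm_sub_le_of_flRound {a : ℝ} (ha : 0 ≤ a) {w w' : Matrix (Fin n) (Fin 1) ℝ}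
    (h : ∀ i, FlRound a (w i 0) (w' i 0)) : ‖w' - w‖ ≤ a * ‖w‖ := by
  refine (norm_le_of_forall_abs_le_mul (B := w) ha fun i j => ?_).trans_eq (by simp)
  rw [Subsingleton.elim j 0]
  exact (h i).abs_sub_le

theorem FlHouseholder.exists_reflector (hε : 0 ≤ ε) (hετ : ε ≤ τ) (hnτ : (n + 1 : ℕ) * ε ≤ τ)
    (hτ : τ ≤ 1 / 1000) (h : FlHouseholder ε x R W Y) :
    ∃ w : Matrix (Fin (n + 1)) (Fin 1) ℝ, wᵀ * w = 1 ∧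
      (∀ i, FlRound (70 * τ) (w i 0) (W i 0)) ∧ (∀ i, FlRound ε (2 * W i 0) (Y 0 i)) ∧
      ‖reflector w * x - padRows (n + 1) R‖ ≤ 6 * τ * ‖x‖ := by
  obtain ⟨s, hs, hcase⟩ := h
  have hs_round : FlRound (6 * τ) ‖x‖ s := by
    rw [norm_eq_sqrt_sum_sq_col]
    exact hs.flRound hε hετ hnτ hτ
  have hs_zero : s = 0 ↔ x = 0 := by
    rw [hs_round.eq_zero_iff (by linarith), norm_eq_zero]
  rcases hcase with ⟨hs0, hR, hW, hY⟩ | ⟨hs0, hR, v, ν, hv_zero, hv, hν, hW, hY⟩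
  · have hW_unit : Wᵀ * W = 1 := by
      ext i j
      rw [Subsingleton.elim i 0, Subsingleton.elim j 0]
      simp [Matrix.mul_apply, hW]
    refine ⟨W, hW_unit, fun i => .refl (by linarith) _, fun i => ?_, ?_⟩
    · have hYW : Y 0 i = 2 * W i 0 := by rw [hW, hY]; split_ifs <;> norm_num
      rw [hYW]
      exact .refl hε _
    · simp [hs_zero.1 hs0, padRows_one_by_one, hR]
  · have hne : x ≠ householderImage x := ne_householderImage (mt hs_zero.2 hs0)
    refine ⟨‖x - householderImage x‖⁻¹ • (x - householderImage x),
      transpose_mul_self_normalize (sub_ne_zero.2 hne),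
      flRound_normalize hε hετ hnτ hτ
        (flRound_sub_householderImage hε hετ hτ hs_round hv_zero hv) hν hW, hY, ?_⟩
    rw [reflector_normalize_sub_mul (norm_householderImage x).symm hne, padRows_one_by_one, hR,
      norm_householderImage_sub_single]
    simpa only [abs_norm] using hs_round.abs_sub_le

theorem FlHouseholder.exists_orthogonal (hε : 0 ≤ ε) (hετ : ε ≤ τ) (hnτ : (n + 1 : ℕ) * ε ≤ τ)
    (hτ : τ ≤ 1 / 1000) (h : FlHouseholder ε x R W Y) :
    ‖W‖ ≤ 1 + 72 * τ ∧ ‖Y‖ ≤ 3 ∧ ∃ Q ∈ Matrix.orthogonalGroup (Fin (n + 1)) ℝ,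
      ‖1 - W * Y - Q‖ ≤ 360 * τ ∧ ‖Q * x - padRows (n + 1) R‖ ≤ 6 * τ * ‖x‖ := by
  obtain ⟨w, hw, hW, hY, hx⟩ := h.exists_reflector hε hετ hnτ hτ
  have hτ_nonneg : 0 ≤ τ := hε.trans hετ
  have hw_norm : ‖w‖ ≤ 1 := norm_le_one_of_transpose_mul_self_eq_one hw
  have hY_round : ∀ i, FlRound (72 * τ) (2 * w i 0) (Y 0 i) := fun i =>
    (((FlRound.refl le_rfl 2).mul (hW i)).trans (hY i)).mono (by nlinarith)
  have hW_sub : ‖W - w‖ ≤ 72 * τ :=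
    (norm_sub_le_of_flRound (by positivity) hW).trans (by nlinarith)
  have hY_sub : ‖Y - (2 : ℝ) • wᵀ‖ ≤ 2 * (72 * τ) := by
    have hcol := norm_sub_le_of_flRound (w := (2 : ℝ) • w) (w' := Yᵀ) (by positivity) hY_round
    rw [← norm_transpose, transpose_sub, transpose_smul, transpose_transpose]
    rw [norm_smul, Real.norm_ofNat] at hcol
    nlinarith
  have hW_le := norm_le_norm_add_norm_sub' W w
  have hY_le := norm_le_norm_add_norm_sub' Y ((2 : ℝ) • wᵀ)
  rw [norm_smul, Real.norm_ofNat, norm_transpose] at hY_le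
  refine ⟨by linarith, by linarith, reflector w, reflector_mem_orthogonalGroup hw, ?_, hx⟩
  exact (norm_one_sub_mul_sub_reflector_le (by linarith) hw hW_sub hY_sub).trans_eq (by ring)

end Householder

section CompactWY

variable {m n : Type*} [Fintype m] [Fintype n] [DecidableEq m] [DecidableEq n] {b b' e : ℝ}
  {P Q Q' : Matrix n n ℝ} {W X : Matrix n m ℝ} {Y : Matrix m n ℝ}

theorem norm_left_factor_le (hQ' : Q' ∈ Matrix.orthogonalGroup n ℝ) (hP : ‖P - Q'‖ ≤ b')
    (hX : ‖X - P * W‖ ≤ e) : ‖X‖ ≤ (1 + b') * ‖W‖ + e := by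
  have hP_norm : ‖P‖ ≤ 1 + b' :=
    (norm_le_norm_add_norm_sub' P Q').trans (add_le_add (norm_orthogonal_le_one hQ') hP)
  calc ‖X‖ ≤ ‖P * W‖ + ‖X - P * W‖ := norm_le_norm_add_norm_sub' X (P * W)
    _ ≤ (1 + b') * ‖W‖ + e := by
      gcongr
      exact (Matrix.l2_opNorm_mul _ _).trans (by gcongr)

theorem norm_one_sub_left_factor_mul_sub_le (hQ : Q ∈ Matrix.orthogonalGroup n ℝ)
    (hQ' : Q' ∈ Matrix.orthogonalGroup n ℝ) (hWY : ‖1 - W * Y - Q‖ ≤ b) (hP : ‖P - Q'‖ ≤ b')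
    (hX : ‖X - P * W‖ ≤ e) : ‖P - X * Y - Q' * Q‖ ≤ (1 + b') * (1 + b) - 1 + e * ‖Y‖ := by
  have hsplit : P - X * Y - Q' * Q = (P * (1 - W * Y) - Q' * Q) - (X - P * W) * Y := by
    rw [Matrix.mul_sub, Matrix.mul_one, Matrix.sub_mul, Matrix.mul_assoc]
    abel
  rw [hsplit]
  refine (norm_sub_le _ _).trans (add_le_add ?_ ?_)
  · exact norm_mul_sub_mul_le (norm_orthogonal_le_one hQ') (norm_orthogonal_le_one hQ) hP hWY
  · exact (Matrix.l2_opNorm_mul _ _).trans (by gcongr)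

theorem norm_mul_sub_le_of_norm_sub_le {B C : Matrix n m ℝ} {g : ℝ} (hP : ‖P - Q‖ ≤ b)
    (hC : ‖C - P * B‖ ≤ g * ‖B‖) : ‖Q * B - C‖ ≤ (b + g) * ‖B‖ := by
  calc ‖Q * B - C‖ = ‖(P - Q) * B + (C - P * B)‖ := by
        rw [← norm_neg, Matrix.sub_mul]
        congr 1
        abel
    _ ≤ b * ‖B‖ + g * ‖B‖ := by
        refine norm_add_le_of_le ((Matrix.l2_opNorm_mul _ _).trans ?_) hC
        gcongr
    _ = (b + g) * ‖B‖ := by ring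

end CompactWY

section TriangularFactor

variable {k l p : ℕ} {Q : Matrix (Fin (k + p)) (Fin (k + p)) ℝ} {Q' : Matrix (Fin p) (Fin p) ℝ}
  {AL : Matrix (Fin (k + p)) (Fin k) ℝ} {AR : Matrix (Fin (k + p)) (Fin l) ℝ}
  {RL : Matrix (Fin k) (Fin k) ℝ} {A12 : Matrix (Fin k) (Fin l) ℝ} {A22 : Matrix (Fin p) (Fin l) ℝ}
  {RR : Matrix (Fin l) (Fin l) ℝ} {a a' c : ℝ}

theorem oneDiag_mul_mul_hcat_sub_padRows :
    oneDiag k Q' * Q * hcat AL AR - padRows (k + p) (vcat (hcat RL A12) (hcat 0 RR))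
      = hcat (oneDiag k Q' * (Q * AL - padRows (k + p) RL))
          (oneDiag k Q' * (Q * AR - vcat A12 A22) + vcat 0 (Q' * A22 - padRows p RR)) := by
  have hvcat : vcat (0 : Matrix (Fin k) (Fin l) ℝ) (Q' * A22 - padRows p RR)
      = vcat A12 (Q' * A22) - vcat A12 (padRows p RR) := by rw [vcat_sub, sub_self]
  rw [padRows_block, mul_hcat, hcat_sub, hvcat, Matrix.mul_sub, padRows_add, oneDiag_mul_vcat,
    Matrix.mul_zero, Matrix.mul_sub, oneDiag_mul_vcat, Matrix.mul_assoc, Matrix.mul_assoc,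
    sub_add_sub_cancel]

theorem norm_oneDiag_mul_mul_hcat_sub_padRows_le (ha : 0 ≤ a) (ha' : 0 ≤ a') (hc : 0 ≤ c)
    (hQ : Q ∈ Matrix.orthogonalGroup (Fin (k + p)) ℝ)
    (hQ' : Q' ∈ Matrix.orthogonalGroup (Fin p) ℝ)
    (hL : ‖Q * AL - padRows (k + p) RL‖ ≤ a * ‖AL‖)
    (hR : ‖Q' * A22 - padRows p RR‖ ≤ a' * ‖A22‖)
    (hA : ‖Q * AR - vcat A12 A22‖ ≤ c * ‖AR‖) :
    ‖oneDiag k Q' * Q * hcat AL AR - padRows (k + p) (vcat (hcat RL A12) (hcat 0 RR))‖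
      ≤ ((1 + a') * (1 + c) * (1 + a) - 1) * ‖hcat AL AR‖ := by
  have hD := oneDiag_mem_orthogonalGroup (k := k) hQ'
  have hAL := norm_le_norm_hcat_left AL AR
  have hAR := norm_le_norm_hcat_right AL AR
  have hA22 : ‖A22‖ ≤ (1 + c) * ‖AR‖ := by
    calc ‖A22‖ ≤ ‖vcat A12 A22‖ := norm_le_norm_vcat_right A12 A22
      _ ≤ ‖Q * AR‖ + ‖Q * AR - vcat A12 A22‖ := norm_le_norm_add_norm_sub _ _
      _ ≤ (1 + c) * ‖AR‖ := by rw [norm_orthogonal_mul hQ]; linarith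
  rw [oneDiag_mul_mul_hcat_sub_padRows (A22 := A22)]
  calc _ ≤ a * ‖AL‖ + (c * ‖AR‖ + a' * ((1 + c) * ‖AR‖)) := by
        refine (norm_hcat_le _ _).trans (add_le_add ?_ ((norm_add_le _ _).trans (add_le_add ?_ ?_)))
        · rwa [norm_orthogonal_mul hD]
        · rwa [norm_orthogonal_mul hD]
        · rw [norm_zero_vcat]
          exact hR.trans (by gcongr)
    _ ≤ a * ‖hcat AL AR‖ + (c * ‖hcat AL AR‖ + a' * ((1 + c) * ‖hcat AL AR‖)) := by gcongr
    _ = (a + (c + a' * (1 + c))) * ‖hcat AL AR‖ := by ring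
    _ ≤ ((1 + a') * (1 + c) * (1 + a) - 1) * ‖hcat AL AR‖ := by
        gcongr
        nlinarith [mul_nonneg ha hc, mul_nonneg ha ha', mul_nonneg (mul_nonneg ha hc) ha']

end TriangularFactor

section ReflectorUpdate

theorem norm_mul_mul_le {m n o : Type*} [Fintype m] [Fintype n] [Fintype o] [DecidableEq m]
    [DecidableEq n] [DecidableEq o] {c : ℝ} {W : Matrix n m ℝ} {Y : Matrix m n ℝ}
    (hWY : ‖W‖ * ‖Y‖ ≤ c) (B : Matrix n o ℝ) : ‖W * (Y * B)‖ ≤ c * ‖B‖ := by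
  rw [← Matrix.mul_assoc]
  refine (Matrix.l2_opNorm_mul _ _).trans ?_
  gcongr
  exact (Matrix.l2_opNorm_mul _ _).trans hWY

variable {mm : SquareMul} {ε η c : ℝ} {N k l n p : ℕ}

theorem AccurateArithmetic.eta_nonneg (h : AccurateArithmetic mm ε N η) : 0 ≤ η :=
  (mul_nonneg N.cast_nonneg h.eps_nonneg).trans h.dim_mul_eps_le

theorem AccurateArithmetic.norm_sub_sub_le (h : AccurateArithmetic mm ε N η) (hl : l ≤ N)
    {A B C : Matrix (Fin n) (Fin l) ℝ} (hC : FlSub ε A B C) :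
    ‖C - (A - B)‖ ≤ η * ‖A - B‖ := by
  have hlη : (l : ℝ) * ε ≤ η :=
    (mul_le_mul_of_nonneg_right (Nat.cast_le.2 hl) h.eps_nonneg).trans h.dim_mul_eps_le
  calc ‖C - (A - B)‖ ≤ Fintype.card (Fin l) * (ε * ‖A - B‖) :=
        norm_le_of_forall_abs_le_mul h.eps_nonneg fun i j => (hC i j).abs_sub_le
    _ = l * ε * ‖A - B‖ := by rw [Fintype.card_fin, mul_assoc]
    _ ≤ η * ‖A - B‖ := by gcongr

theorem AccurateArithmetic.norm_mul_mul_sub_le (h : AccurateArithmetic mm ε N η) (hn : n ≤ N)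
    (hk : k ≤ N) (hl : l ≤ N) {W : Matrix (Fin n) (Fin k) ℝ} {Y : Matrix (Fin k) (Fin n) ℝ}
    {B T : Matrix (Fin n) (Fin l) ℝ} {S : Matrix (Fin k) (Fin l) ℝ} (hS : FlMul mm ε Y B S)
    (hT : FlMul mm ε W S T) :
    ‖T - W * (Y * B)‖ ≤ ((1 + η) ^ 2 - 1) * (‖W‖ * ‖Y‖ * ‖B‖) := by
  have hη := h.eta_nonneg
  have hS_sub : ‖S - Y * B‖ ≤ η * (‖Y‖ * ‖B‖) := h.norm_mul_sub_le hk hn hl hS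
  have hS_norm : ‖S‖ ≤ ‖Y‖ * ‖B‖ + η * (‖Y‖ * ‖B‖) :=
    (norm_le_norm_add_norm_sub' S (Y * B)).trans (add_le_add (Matrix.l2_opNorm_mul Y B) hS_sub)
  calc ‖T - W * (Y * B)‖ = ‖(T - W * S) + W * (S - Y * B)‖ := by
        rw [Matrix.mul_sub, sub_add_sub_cancel]
    _ ≤ η * (‖W‖ * (‖Y‖ * ‖B‖ + η * (‖Y‖ * ‖B‖))) + ‖W‖ * (η * (‖Y‖ * ‖B‖)) := by
        refine norm_add_le_of_le ((h.norm_mul_sub_le hn hk hl hT).trans ?_)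
          ((Matrix.l2_opNorm_mul _ _).trans ?_) <;> gcongr
    _ = ((1 + η) ^ 2 - 1) * (‖W‖ * ‖Y‖ * ‖B‖) := by ring

theorem AccurateArithmetic.norm_sub_sub_le_of_norm_sub_le (h : AccurateArithmetic mm ε N η)
    (hη : 3 * η ≤ 1) (hl : l ≤ N) (hc : 1 ≤ c) {B C T Z : Matrix (Fin n) (Fin l) ℝ}
    (hC : FlSub ε B T C) (hZ : ‖Z‖ ≤ c * ‖B‖) (hT : ‖T - Z‖ ≤ ((1 + η) ^ 2 - 1) * (c * ‖B‖)) :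
    ‖C - (B - Z)‖ ≤ 12 * η * c * ‖B‖ := by
  have hη_nonneg := h.eta_nonneg
  have hBT : ‖B - T‖ ≤ c * ‖B‖ + (1 + η) ^ 2 * (c * ‖B‖) := by
    refine norm_sub_le_of_le (le_mul_of_one_le_left (norm_nonneg B) hc)
      ((norm_le_norm_add_norm_sub' T Z).trans ?_)
    linarith
  have hcube : (1 + η) ^ 3 - 1 ≤ 6 * η :=
    (one_add_pow_sub_one_le hη_nonneg hη).trans_eq (by push_cast; ring)
  calc ‖C - (B - Z)‖ = ‖C - (B - T) - (T - Z)‖ := by congr 1; abel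
    _ ≤ η * (c * ‖B‖ + (1 + η) ^ 2 * (c * ‖B‖)) + ((1 + η) ^ 2 - 1) * (c * ‖B‖) :=
        norm_sub_le_of_le ((h.norm_sub_sub_le hl hC).trans (by gcongr)) hT
    _ = (η + ((1 + η) ^ 3 - 1)) * (c * ‖B‖) := by ring
    _ ≤ (12 * η) * (c * ‖B‖) := by gcongr; linarith
    _ = 12 * η * c * ‖B‖ := by ring

theorem AccurateArithmetic.norm_sub_one_sub_mul_mul_le (h : AccurateArithmetic mm ε N η)
    (hη : 3 * η ≤ 1) (hn : n ≤ N) (hk : k ≤ N) (hl : l ≤ N) (hc : 1 ≤ c)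
    {W : Matrix (Fin n) (Fin k) ℝ} {Y : Matrix (Fin k) (Fin n) ℝ} (hWY : ‖W‖ * ‖Y‖ ≤ c)
    {B C T : Matrix (Fin n) (Fin l) ℝ} {S : Matrix (Fin k) (Fin l) ℝ}
    (hS : FlMul mm ε Y B S) (hT : FlMul mm ε W S T) (hC : FlSub ε B T C) :
    ‖C - (1 - W * Y) * B‖ ≤ 12 * η * c * ‖B‖ := by
  have hη_nonneg := h.eta_nonneg
  rw [Matrix.sub_mul, Matrix.one_mul, Matrix.mul_assoc]
  refine h.norm_sub_sub_le_of_norm_sub_le hη hl hc hC (norm_mul_mul_le hWY _)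
    ((h.norm_mul_mul_sub_le hn hk hl hS hT).trans ?_)
  gcongr
  nlinarith

theorem AccurateArithmetic.norm_sub_oneDiag_mul_le (h : AccurateArithmetic mm ε N η)
    (hη : 3 * η ≤ 1) (hp : p ≤ N) (hk : k ≤ N) (hl : l ≤ N) (hc : 1 ≤ c)
    {W : Matrix (Fin p) (Fin l) ℝ} {Y : Matrix (Fin l) (Fin p) ℝ} (hWY : ‖W‖ * ‖Y‖ ≤ c)
    {B C : Matrix (Fin (k + p)) (Fin k) ℝ} {S : Matrix (Fin l) (Fin k) ℝ}
    {T : Matrix (Fin p) (Fin k) ℝ} (hS : FlMul mm ε Y (B.submatrix (Fin.natAdd k) id) S)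
    (hT : FlMul mm ε W S T) (hC : FlSub ε B (vcat 0 T) C) :
    ‖C - oneDiag k (1 - W * Y) * B‖ ≤ 12 * η * c * ‖B‖ := by
  have hη_nonneg := h.eta_nonneg
  have hrows : ‖B.submatrix (Fin.natAdd k) id‖ ≤ ‖B‖ := norm_submatrix_natAdd_le B
  rw [← one_sub_vcat_mul_hcat, Matrix.sub_mul, Matrix.one_mul, Matrix.mul_assoc, hcat_zero_mul,
    vcat_mul, Matrix.zero_mul]
  refine h.norm_sub_sub_le_of_norm_sub_le hη hk hc hC ?_ ?_
  · rw [norm_zero_vcat]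
    exact (norm_mul_mul_le hWY _).trans (by gcongr)
  · rw [vcat_sub, sub_self, norm_zero_vcat]
    refine (h.norm_mul_mul_sub_le hp hl hk hS hT).trans ?_
    gcongr
    nlinarith

theorem AccurateArithmetic.norm_sub_one_sub_mul_le (h : AccurateArithmetic mm ε N η)
    (hη : 3 * η ≤ 1) (hc : 1 ≤ c) {W Y P C : Matrix (Fin N) (Fin N) ℝ} (hWY : ‖W‖ * ‖Y‖ ≤ c)
    (hP : FlMul mm ε W Y P) (hC : FlSub ε 1 P C) : ‖C - (1 - W * Y)‖ ≤ 12 * η * c := by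
  have hη_nonneg := h.eta_nonneg
  have hWY_one : ‖W‖ * ‖Y‖ ≤ c * ‖(1 : Matrix (Fin N) (Fin N) ℝ)‖ := by
    calc ‖W‖ * ‖Y‖ = ‖W‖ * ‖Y * 1‖ := by rw [Matrix.mul_one]
      _ ≤ ‖W‖ * ‖Y‖ * ‖(1 : Matrix (Fin N) (Fin N) ℝ)‖ := by
        rw [mul_assoc]
        gcongr
        exact Matrix.l2_opNorm_mul _ _
      _ ≤ c * ‖(1 : Matrix (Fin N) (Fin N) ℝ)‖ := by gcongr
  refine (h.norm_sub_sub_le_of_norm_sub_le hη le_rfl hc hC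
    ((Matrix.l2_opNorm_mul W Y).trans hWY_one) ?_).trans
    (mul_le_of_le_one_right (by positivity) norm_one_le_one)
  refine (h.norm_mul_sub_le le_rfl le_rfl le_rfl hP).trans ?_
  have hη_sq : η ≤ (1 + η) ^ 2 - 1 := by nlinarith
  exact mul_le_mul hη_sq hWY_one (by positivity) (hη_nonneg.trans hη_sq)

end ReflectorUpdate

section Recursion

variable {mm : SquareMul} {ε η δ θ g : ℝ} {N n m k l p : ℕ}

theorem FlQRR.cols_pos {A : Matrix (Fin n) (Fin m) ℝ} {R : Matrix (Fin m) (Fin m) ℝ}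
    {W : Matrix (Fin n) (Fin m) ℝ} {Y : Matrix (Fin m) (Fin n) ℝ}
    (h : FlQRR mm ε n m A R W Y) : 0 < m := by
  cases h <;> omega

/-- The invariant of the recursion for a computed decomposition `[R, W, Y]` of `A`: the factors of
`1 - W * Y` stay bounded, and some exactly orthogonal `Q` is close to `1 - W * Y` and nearly maps
`A` to `[R; 0]`. Each of the `2 * m - 1` nodes of the recursion tree multiplies `1 +` the error by
`1 + δ` or `1 + θ`. -/
structure QRRStable (δ θ : ℝ) (A : Matrix (Fin n) (Fin m) ℝ) (R : Matrix (Fin m) (Fin m) ℝ)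
    (W : Matrix (Fin n) (Fin m) ℝ) (Y : Matrix (Fin m) (Fin n) ℝ) : Prop where
  norm_left_le : ‖W‖ ≤ m * (1 + δ) ^ (2 * m - 1)
  norm_right_le : ‖Y‖ ≤ 3 * m
  exists_orthogonal : ∃ Q ∈ Matrix.orthogonalGroup (Fin n) ℝ,
    ‖1 - W * Y - Q‖ ≤ (1 + δ) ^ (2 * m - 1) - 1 ∧
      ‖Q * A - padRows n R‖ ≤ ((1 + θ) ^ (2 * m - 1) - 1) * ‖A‖

theorem pow_mul_mul_pow_two_mul_sub_one (x : ℝ) (hk : 0 < k) (hl : 0 < l) :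
    x ^ (2 * l - 1) * x * x ^ (2 * k - 1) = x ^ (2 * (k + l) - 1) := by
  rw [← pow_succ, ← pow_add]
  congr 1
  omega

theorem one_le_one_add_pow (hδ : 0 ≤ δ) (i : ℕ) : 1 ≤ (1 + δ) ^ i :=
  one_le_pow₀ (le_add_of_nonneg_right hδ)

theorem norm_hcat_vcat_zero_le {P Q' : Matrix (Fin (k + p)) (Fin (k + p)) ℝ}
    {W X : Matrix (Fin (k + p)) (Fin k) ℝ} {W' : Matrix (Fin p) (Fin l) ℝ} {u v : ℝ} (hu : 1 ≤ u)
    (hv : 1 ≤ v) (hδ : 0 ≤ δ) (hQ' : Q' ∈ Matrix.orthogonalGroup (Fin (k + p)) ℝ)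
    (hP : ‖P - Q'‖ ≤ v - 1) (hX : ‖X - P * W‖ ≤ δ * ‖W‖) (hW : ‖W‖ ≤ k * u)
    (hW' : ‖W'‖ ≤ l * v) : ‖hcat X (vcat 0 W')‖ ≤ (k + l) * (v * (1 + δ) * u) := by
  have hX_norm : ‖X‖ ≤ v * (1 + δ) * ‖W‖ := by
    refine (norm_left_factor_le hQ' hP hX).trans ?_
    rw [add_sub_cancel, ← add_mul]
    gcongr
    nlinarith
  calc ‖hcat X (vcat 0 W')‖ ≤ ‖X‖ + ‖W'‖ := (norm_hcat_le _ _).trans_eq (by rw [norm_zero_vcat])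
    _ ≤ v * (1 + δ) * (k * u) + l * (v * 1 * 1) := by
        gcongr
        · exact hX_norm.trans (by gcongr)
        · rwa [mul_one, mul_one]
    _ ≤ v * (1 + δ) * (k * u) + l * (v * (1 + δ) * u) := by
        gcongr
        exact le_add_of_nonneg_right hδ
    _ = (k + l) * (v * (1 + δ) * u) := by ring

theorem QRRStable.split (hk : 0 < k) (hl : 0 < l) (hδ : 0 ≤ δ) (hθ : 0 ≤ θ)
    {AL : Matrix (Fin (k + p)) (Fin k) ℝ} {AR : Matrix (Fin (k + p)) (Fin l) ℝ}
    {RL : Matrix (Fin k) (Fin k) ℝ} {WL X : Matrix (Fin (k + p)) (Fin k) ℝ}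
    {YL : Matrix (Fin k) (Fin (k + p)) ℝ} {A12 : Matrix (Fin k) (Fin l) ℝ}
    {A22 : Matrix (Fin p) (Fin l) ℝ} {RR : Matrix (Fin l) (Fin l) ℝ}
    {WR : Matrix (Fin p) (Fin l) ℝ} {YR : Matrix (Fin l) (Fin p) ℝ}
    (hL : QRRStable δ θ AL RL WL YL) (hR : QRRStable δ θ A22 RR WR YR)
    (hA : ‖vcat A12 A22 - (1 - WL * YL) * AR‖ ≤ g * ‖AR‖)
    (hX : ‖X - oneDiag k (1 - WR * YR) * WL‖ ≤ g * ‖WL‖)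
    (hgδ : g ≤ δ) (hgWY : g * ‖WL‖ * ‖YL‖ ≤ δ) (hgθ : (1 + δ) ^ (2 * k - 1) - 1 + g ≤ θ) :
    QRRStable δ θ (hcat AL AR) (vcat (hcat RL A12) (hcat 0 RR)) (hcat X (vcat 0 WR))
      (vcat YL (hcat 0 YR)) := by
  obtain ⟨QL, hQL, hWYL, hRL⟩ := hL.exists_orthogonal
  obtain ⟨QR, hQR, hWYR, hRR⟩ := hR.exists_orthogonal
  have hD := oneDiag_mem_orthogonalGroup (k := k) hQR
  have hP : ‖oneDiag k (1 - WR * YR) - oneDiag k QR‖ ≤ (1 + δ) ^ (2 * l - 1) - 1 := by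
    rwa [norm_oneDiag_sub_oneDiag]
  have hδL := one_le_one_add_pow hδ (2 * k - 1)
  have hδR := one_le_one_add_pow hδ (2 * l - 1)
  refine ⟨?_, ?_, oneDiag k QR * QL, mul_mem hD hQL, ?_, ?_⟩
  · rw [← pow_mul_mul_pow_two_mul_sub_one _ hk hl, Nat.cast_add]
    exact norm_hcat_vcat_zero_le hδL hδR hδ hD hP (hX.trans (by gcongr)) hL.norm_left_le
      hR.norm_left_le
  · refine (norm_vcat_le _ _).trans ?_
    rw [norm_zero_hcat]
    push_cast
    linarith [hL.norm_right_le, hR.norm_right_le]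
  · rw [hcat_mul_vcat, add_comm (X * YL), ← sub_sub, one_sub_vcat_mul_hcat,
      ← pow_mul_mul_pow_two_mul_sub_one _ hk hl]
    refine (norm_one_sub_left_factor_mul_sub_le hQL hD hWYL hP hX).trans ?_
    nlinarith [mul_le_mul hδR hδL zero_le_one (zero_le_one.trans hδR)]
  · refine (norm_oneDiag_mul_mul_hcat_sub_padRows_le (sub_nonneg.2 (one_le_one_add_pow hθ _))
      (sub_nonneg.2 (one_le_one_add_pow hθ _)) hθ hQL hQR hRL hRR
      ((norm_mul_sub_le_of_norm_sub_le hWYL hA).trans (by gcongr))).trans_eq ?_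
    rw [← pow_mul_mul_pow_two_mul_sub_one _ hk hl]
    ring

theorem FlHouseholder.qrrStable (h : AccurateArithmetic mm ε N η) (hη : η ≤ 1 / 1000)
    (hδ : 360 * η ≤ δ) (hθ : 6 * η ≤ θ) (hn : n + 1 ≤ N) {x : Matrix (Fin (n + 1)) (Fin 1) ℝ}
    {R : Matrix (Fin 1) (Fin 1) ℝ} {W : Matrix (Fin (n + 1)) (Fin 1) ℝ}
    {Y : Matrix (Fin 1) (Fin (n + 1)) ℝ} (hx : FlHouseholder ε x R W Y) :
    QRRStable δ θ x R W Y := by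
  have hη_nonneg := h.eta_nonneg
  have hnη : (n + 1 : ℕ) * ε ≤ η :=
    (mul_le_mul_of_nonneg_right (Nat.cast_le.2 hn) h.eps_nonneg).trans h.dim_mul_eps_le
  have hεη : ε ≤ η :=
    (le_mul_of_one_le_left h.eps_nonneg (Nat.one_le_cast.2 n.succ_pos)).trans hnη
  obtain ⟨hW, hY, Q, hQ, hQ_sub, hQ_mul⟩ := hx.exists_orthogonal h.eps_nonneg hεη hnη hη
  refine ⟨hW.trans ?_, hY.trans_eq (by norm_num), Q, hQ, hQ_sub.trans ?_, hQ_mul.trans ?_⟩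
  · norm_num
    linarith
  · norm_num
    linarith
  · norm_num
    gcongr

theorem one_add_pow_two_mul_sub_one_le (hδ : 0 ≤ δ) (hNδ : 4 * N * δ ≤ 1) (hm : m ≤ N) :
    (1 + δ) ^ (2 * m - 1) - 1 ≤ 4 * N * δ := by
  calc (1 + δ) ^ (2 * m - 1) - 1 ≤ (1 + δ) ^ (2 * N) - 1 := by
        gcongr
        · exact le_add_of_nonneg_right hδ
        · omega
    _ ≤ 2 * ((2 * N : ℕ) * δ) := one_add_pow_sub_one_le hδ (by push_cast; nlinarith)
    _ = 4 * N * δ := by push_cast; ring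

theorem QRRStable.norm_mul_norm_le (hδ : 0 ≤ δ) (hNδ : 4 * N * δ ≤ 1) (hm : m ≤ N)
    {A : Matrix (Fin n) (Fin m) ℝ} {R : Matrix (Fin m) (Fin m) ℝ} {W : Matrix (Fin n) (Fin m) ℝ}
    {Y : Matrix (Fin m) (Fin n) ℝ} (h : QRRStable δ θ A R W Y) : ‖W‖ * ‖Y‖ ≤ 6 * N ^ 2 := by
  have hmN : (m : ℝ) ≤ N := Nat.cast_le.2 hm
  have hpow : (1 + δ) ^ (2 * m - 1) ≤ 2 := by
    linarith [one_add_pow_two_mul_sub_one_le hδ hNδ hm]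
  calc ‖W‖ * ‖Y‖ ≤ (m * (1 + δ) ^ (2 * m - 1)) * (3 * m) := by
        gcongr
        exacts [h.norm_left_le, h.norm_right_le]
    _ ≤ (N * 2) * (3 * N) := by gcongr
    _ = 6 * N ^ 2 := by ring

theorem pow_mul_le_pow_mul (hN : 1 ≤ N) (hη : 0 ≤ η) {i j : ℕ} (hij : i ≤ j) :
    (N : ℝ) ^ i * η ≤ N ^ j * η := by
  gcongr
  exact Nat.one_le_cast.2 hN

theorem FlQRR.qrrStable (h : AccurateArithmetic mm ε N η) (hη : 6000 * N ^ 6 * η ≤ 1)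
    {A : Matrix (Fin n) (Fin m) ℝ} {R : Matrix (Fin m) (Fin m) ℝ} {W : Matrix (Fin n) (Fin m) ℝ}
    {Y : Matrix (Fin m) (Fin n) ℝ} (hA : FlQRR mm ε n m A R W Y) (hn : n ≤ N) (hm : m ≤ N) :
    QRRStable (600 * N ^ 4 * η) (3000 * N ^ 5 * η) A R W Y := by
  have hN : 1 ≤ N := hA.cols_pos.trans_le hm
  have hc : (1 : ℝ) ≤ 6 * N ^ 2 := by
    linarith [one_le_pow₀ (Nat.one_le_cast.2 hN) (n := 2) (M₀ := ℝ)]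
  have hη_nonneg := h.eta_nonneg
  have h02 := pow_mul_le_pow_mul hN hη_nonneg (show 0 ≤ 2 by norm_num)
  have h24 := pow_mul_le_pow_mul hN hη_nonneg (show 2 ≤ 4 by norm_num)
  have h45 := pow_mul_le_pow_mul hN hη_nonneg (show 4 ≤ 5 by norm_num)
  have h56 := pow_mul_le_pow_mul hN hη_nonneg (show 5 ≤ 6 by norm_num)
  have hNδ : 4 * N * (600 * N ^ 4 * η) ≤ 1 := by linarith
  have hδ : 0 ≤ 600 * N ^ 4 * η := by positivity
  have hθ : 0 ≤ 3000 * N ^ 5 * η := by positivity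
  have hη_small : 3 * η ≤ 1 := by linarith
  induction hA with
  | column hx => exact hx.qrrStable h (by linarith) (by linarith) (by linarith) hn
  | @split k l p hk _ _ AL AR RL WL YL _ S T A12 A22 hS hT hA22 RR WR YR hR S' T' X hS' hT' hX
      ihL ihR =>
    have hL_stable := ihL hn (by omega)
    have hR_stable := ihR (by omega) (by omega)
    have hWYL := hL_stable.norm_mul_norm_le hδ hNδ (by omega)
    have hWYR := hR_stable.norm_mul_norm_le hδ hNδ (by omega)
    have hA22_sub := h.norm_sub_one_sub_mul_mul_le hη_small hn (by omega) (by omega) hc hWYL hS hT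
      hA22
    have hX_sub := h.norm_sub_oneDiag_mul_le hη_small (by omega) (by omega) (by omega) hc hWYR hS'
      hT' hX
    refine hL_stable.split hk hR.cols_pos hδ hθ hR_stable hA22_sub hX_sub (by linarith) ?_ ?_
    · calc 12 * η * (6 * N ^ 2) * ‖WL‖ * ‖YL‖ ≤ 12 * η * (6 * N ^ 2) * (6 * N ^ 2) := by
            rw [mul_assoc _ ‖WL‖]
            gcongr
        _ = 432 * N ^ 4 * η := by ring
        _ ≤ 600 * N ^ 4 * η := by gcongr; norm_num
    · linarith [one_add_pow_two_mul_sub_one_le hδ hNδ (show k ≤ N by omega)]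

end Recursion

section RURV

variable {mm : SquareMul} {ε η : ℝ} {n : ℕ}

theorem FlQR.exists_orthogonal (h : AccurateArithmetic mm ε n η) (hη : 12000 * n ^ 6 * η ≤ 1)
    {A Q R : Matrix (Fin n) (Fin n) ℝ} (hA : FlQR mm ε A Q R) :
    ∃ H ∈ Matrix.orthogonalGroup (Fin n) ℝ, ‖Q - H‖ ≤ 3000 * n ^ 5 * η ∧
      ‖Hᵀ * A - R‖ ≤ 12000 * n ^ 6 * η * ‖A‖ := by
  obtain ⟨W, Y, P, hQRR, hP, hQ⟩ := hA
  have hn : 1 ≤ n := hQRR.cols_pos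
  have hη_nonneg := h.eta_nonneg
  have h02 := pow_mul_le_pow_mul hn hη_nonneg (show 0 ≤ 2 by norm_num)
  have h25 := pow_mul_le_pow_mul hn hη_nonneg (show 2 ≤ 5 by norm_num)
  have h56 := pow_mul_le_pow_mul hn hη_nonneg (show 5 ≤ 6 by norm_num)
  have hnδ : 4 * n * (600 * n ^ 4 * η) ≤ 1 := by linarith
  have hnθ : 4 * n * (3000 * n ^ 5 * η) ≤ 1 := by linarith
  have hc : (1 : ℝ) ≤ 6 * n ^ 2 := by
    linarith [one_le_pow₀ (Nat.one_le_cast.2 hn) (n := 2) (M₀ := ℝ)]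
  have hstable := hQRR.qrrStable h (by linarith) le_rfl le_rfl
  obtain ⟨H, hH, hH_sub, hH_mul⟩ := hstable.exists_orthogonal
  have hWY := hstable.norm_mul_norm_le (by positivity) hnδ le_rfl
  have hQ_sub := h.norm_sub_one_sub_mul_le (by linarith) hc hWY hP hQ
  have hδ_pow := one_add_pow_two_mul_sub_one_le (by positivity) hnδ le_rfl
  have hθ_pow := one_add_pow_two_mul_sub_one_le (by positivity) hnθ le_rfl
  refine ⟨Hᵀ, transpose_mem_orthogonalGroup hH, ?_, ?_⟩
  · rw [← norm_transpose, transpose_sub, transpose_transpose]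
    refine (norm_sub_le_norm_sub_add_norm_sub _ (1 - W * Y) _).trans ?_
    linarith
  · rw [transpose_transpose, ← padRows_self R]
    refine hH_mul.trans ?_
    gcongr
    linarith

theorem AccurateArithmetic.norm_sub_mul_le_of_norm_sub_le (h : AccurateArithmetic mm ε n η)
    {A B B' C : Matrix (Fin n) (Fin n) ℝ} {b : ℝ} (hC : FlMul mm ε A B C) (hB' : ‖B'‖ ≤ 1)
    (hB : ‖B - B'‖ ≤ b) : ‖C - A * B'‖ ≤ ((1 + η) * (1 + b) - 1) * ‖A‖ := by
  have hη_nonneg := h.eta_nonneg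
  have hB_norm : ‖B‖ ≤ 1 + b := (norm_le_norm_add_norm_sub' B B').trans (add_le_add hB' hB)
  calc ‖C - A * B'‖ = ‖(C - A * B) + A * (B - B')‖ := by
        rw [Matrix.mul_sub, sub_add_sub_cancel]
    _ ≤ η * (‖A‖ * (1 + b)) + ‖A‖ * b := by
        refine norm_add_le_of_le ((h.norm_mul_sub_le le_rfl le_rfl le_rfl hC).trans ?_)
          ((Matrix.l2_opNorm_mul _ _).trans ?_) <;> gcongr
    _ = ((1 + η) * (1 + b) - 1) * ‖A‖ := by ring

theorem norm_orthogonal_mul_mul_sub_le {n : Type*} [Fintype n] [DecidableEq n]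
    {U V : Matrix n n ℝ} (hU : U ∈ Matrix.orthogonalGroup n ℝ)
    (hV : V ∈ Matrix.orthogonalGroup n ℝ) (A B R : Matrix n n ℝ) :
    ‖U * R * V - A‖ ≤ ‖B - A * Vᵀ‖ + ‖Uᵀ * B - R‖ := by
  have hVV : Vᵀ * V = 1 := transpose_mul_self_of_mem_orthogonalGroup hV
  have hUU : U * Uᵀ = 1 := (Matrix.mem_orthogonalGroup_iff n ℝ).1 hU
  have hsplit : U * R * V - A = ((B - A * Vᵀ) - U * (Uᵀ * B - R)) * V := by
    rw [Matrix.mul_sub, ← Matrix.mul_assoc U, hUU, Matrix.one_mul, sub_sub_sub_comm, sub_self,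
      zero_sub, neg_sub, Matrix.sub_mul, Matrix.mul_assoc A, hVV, Matrix.mul_one]
  rw [hsplit]
  calc _ ≤ ‖(B - A * Vᵀ) - U * (Uᵀ * B - R)‖ * ‖V‖ := Matrix.l2_opNorm_mul _ _
    _ ≤ ‖(B - A * Vᵀ) - U * (Uᵀ * B - R)‖ :=
        mul_le_of_le_one_right (norm_nonneg _) (norm_orthogonal_le_one hV)
    _ ≤ ‖B - A * Vᵀ‖ + ‖Uᵀ * B - R‖ := by
        rw [← norm_orthogonal_mul hU (Uᵀ * B - R)]
        exact norm_sub_le _ _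

theorem FlRURV.exists_orthogonal (h : AccurateArithmetic mm ε n η) (hη : 12000 * n ^ 6 * η ≤ 1)
    {A B U R V : Matrix (Fin n) (Fin n) ℝ} (hA : FlRURV mm ε A B U R V) :
    ∃ δA Uhat Vhat : Matrix (Fin n) (Fin n) ℝ,
      Uhat ∈ Matrix.orthogonalGroup (Fin n) ℝ ∧ Vhat ∈ Matrix.orthogonalGroup (Fin n) ℝ ∧
      A + δA = Uhat * R * Vhat ∧ ‖δA‖ ≤ 36000 * n ^ 6 * η * ‖A‖ ∧
      ‖U - Uhat‖ ≤ 36000 * n ^ 6 * η ∧ ‖V - Vhat‖ ≤ 36000 * n ^ 6 * η := by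
  obtain ⟨R₀, Ahat, hV, hAhat, hU⟩ := hA
  have hn : 1 ≤ n := by
    obtain ⟨W, Y, P, hQRR, -⟩ := hV
    exact hQRR.cols_pos
  obtain ⟨Vhat, hVhat, hV_sub, -⟩ := hV.exists_orthogonal h hη
  obtain ⟨Uhat, hUhat, hU_sub, hR⟩ := hU.exists_orthogonal h hη
  have hη_nonneg := h.eta_nonneg
  have h05 := pow_mul_le_pow_mul hn hη_nonneg (show 0 ≤ 5 by norm_num)
  have h56 := pow_mul_le_pow_mul hn hη_nonneg (show 5 ≤ 6 by norm_num)
  refine ⟨Uhat * R * Vhat - A, Uhat, Vhat, hUhat, hVhat, add_sub_cancel _ _, ?_,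
    hU_sub.trans (by linarith), hV_sub.trans (by linarith)⟩
  have hAhat_sub : ‖Ahat - A * Vhatᵀ‖ ≤ 12000 * n ^ 6 * η * ‖A‖ := by
    refine (h.norm_sub_mul_le_of_norm_sub_le (b := 3000 * n ^ 5 * η) hAhat ?_ ?_).trans ?_
    · rw [norm_transpose]
      exact norm_orthogonal_le_one hVhat
    · rwa [← transpose_sub, norm_transpose]
    · gcongr
      nlinarith
  have hAhat_norm : ‖Ahat‖ ≤ 2 * ‖A‖ := by
    have hAV : ‖A * Vhatᵀ‖ ≤ ‖A‖ := by
      refine (Matrix.l2_opNorm_mul _ _).trans (mul_le_of_le_one_right (norm_nonneg _) ?_)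
      rw [norm_transpose]
      exact norm_orthogonal_le_one hVhat
    have hAhat_le := norm_le_norm_add_norm_sub' Ahat (A * Vhatᵀ)
    nlinarith [norm_nonneg A]
  calc ‖Uhat * R * Vhat - A‖ ≤ ‖Ahat - A * Vhatᵀ‖ + ‖Uhatᵀ * Ahat - R‖ :=
        norm_orthogonal_mul_mul_sub_le hUhat hVhat A Ahat R
    _ ≤ 12000 * n ^ 6 * η * ‖A‖ + 12000 * n ^ 6 * η * (2 * ‖A‖) := by
        gcongr
        exact hR.trans (by gcongr)
    _ = 36000 * n ^ 6 * η * ‖A‖ := by ring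

end RURV

end FloatURV

theorem mainTheorem6 (mm : FloatURV.SquareMul) (hmm : FloatURV.StableMul mm) :
    ∃ (K : ℝ) (c : ℕ), ∀ n : ℕ, ∃ ε₀ : ℝ, 0 < ε₀ ∧ ∀ ε : ℝ, 0 < ε → ε ≤ ε₀ →
      ∀ A B U R V : Matrix (Fin n) (Fin n) ℝ, FloatURV.FlRURV mm ε A B U R V →
        ∃ δA Uhat Vhat : Matrix (Fin n) (Fin n) ℝ,
          Uhat ∈ Matrix.orthogonalGroup (Fin n) ℝ ∧ Vhat ∈ Matrix.orthogonalGroup (Fin n) ℝ ∧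
          A + δA = Uhat * R * Vhat ∧
          ‖δA‖ ≤ K * (n : ℝ) ^ c * ε * ‖A‖ ∧
          ‖U - Uhat‖ ≤ K * (n : ℝ) ^ c * ε ∧
          ‖V - Vhat‖ ≤ K * (n : ℝ) ^ c * ε := by
  obtain ⟨C, e, harith⟩ := hmm.exists_eventually_accurateArithmetic
  refine ⟨36000 * C, e + 6, fun n => ?_⟩
  rcases Nat.eq_zero_or_pos n with rfl | hn
  · refine ⟨1, one_pos, fun ε _ _ A B U R V h => ?_⟩
    obtain ⟨_, _, ⟨_, _, _, hQRR, _⟩, _⟩ := h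
    exact absurd hQRR.cols_pos (lt_irrefl 0)
  obtain ⟨ε₀, hε₀, hsmall⟩ := mem_nhdsGT_iff_exists_Ioc_subset.1
    ((harith n hn).and (FloatURV.eventually_mul_le_one (12000 * n ^ 6 * (C * n ^ e))))
  refine ⟨ε₀, hε₀, fun ε hε hεε₀ A B U R V h => ?_⟩
  obtain ⟨hη, hη_small⟩ := hsmall ⟨hε, hεε₀⟩
  have hK : 36000 * C * (n : ℝ) ^ (e + 6) * ε = 36000 * n ^ 6 * (C * n ^ e * ε) := by ring
  rw [hK]
  exact h.exists_orthogonal hη (by linarith)
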